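/- Let $\Sigma=\mathbb{C}/2\pi i\mathbb{Z}$ be the flat cylinder with coordinate $z=x+iy$, and let $\mathcal{M}_2^{\infty}$ be the space of degree-two meromorphic maps $W:\Sigma\to\mathbb{CP}^1$ with $W\to\infty$ as $x\to-\infty$ and $W\to 0$ as $x\to+\infty$; these are exactly the maps $$W_\zeta(z)=\frac{\zeta_1e^{z}+\zeta_2}{e^{2z}+\zeta_0e^{z}},\qquad \zeta=(\zeta_0,\zeta_1,\zeta_2)\in\mathbb{C}^3,$$ with numerator and denominator coprime as polynomials in $w=e^z$. Equip $\mathcal{M}_2^{\infty}$ with the $L^2$ metric $$\gamma_\zeta(X,Y)=\int_{\Sigma}\frac{4\,\mathrm{Re}\big(\partial_XW_\zeta\,\overline{\partial_YW_\zeta}\big)}{(1+|W_\zeta|^2)^2}\,dx\,dy .$$ Consider the surface $$\Xi_\infty=\Big\{z\mapsto\frac{e^{-z}+\alpha}{e^{z}+\alpha}\;:\;\alpha\in\mathbb{C}\setminus\{-1,1\}\Big\}\subset\mathcal{M}_2^{\infty},$$ with global coordinates $(\mathrm{Re}\,\alpha,\mathrm{Im}\,\alpha)$ and the metric induced by $\gamma$.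 Then the integrals defining the induced metric converge, the induced metric is positive definite and of class $C^2$ on $\mathbb{C}\setminus\{-1,1\}$, and its scalar curvature $R(\alpha)$ satisfies $$\lim_{\alpha\to 1}R(\alpha)=+\infty\qquad\text{and}\qquad\lim_{\alpha\to -1}R(\alpha)=+\infty ,$$ where $\alpha$ tends to $\pm1$ in $\mathbb{C}\setminus\{-1,1\}$ (at $\alpha=\pm1$ the degree of the map drops to one). -/

import Mathlib

open MeasureTheory Filter Topology

noncomputable section

namespace Lump

/-! ### Two-lumps on the cylinder with endpoints `∞` and `0` -/

/-- The monic denominator `w² + ζ₀ w` of a two-lump with endpoints `(∞, 0)`, as a polynomial in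
`w = e^z`. -/
def denominator (ζ : Fin 3 → ℂ) : Polynomial ℂ :=
  Polynomial.X ^ 2 + Polynomial.C (ζ 0) * Polynomial.X

/-- The numerator `ζ₁ w + ζ₂` of a two-lump with endpoints `(∞, 0)`. -/
def numerator (ζ : Fin 3 → ℂ) : Polynomial ℂ :=
  Polynomial.C (ζ 1) * Polynomial.X + Polynomial.C (ζ 2)

/-- The moduli space `M₂^∞` of degree-two lumps `W` on the cylinder `ℂ / 2πiℤ` with
`W → ∞` as `Re z → -∞` and `W → 0` as `Re z → +∞`, in its global complex coordinates
`ζ = (ζ₀, ζ₁, ζ₂)`: each such lump is `z ↦ (ζ₁ e^z + ζ₂) / (e^{2z} + ζ₀ e^z)` for a unique `ζ`,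
and the degree is two exactly when numerator and denominator have no common factor. -/
def moduliTwoInfty : Set (Fin 3 → ℂ) :=
  {ζ | IsCoprime (denominator ζ) (numerator ζ)}

/-- The lump with coordinates `ζ`, in the inhomogeneous coordinate of the Riemann sphere.  (At the
poles, a null set of the cylinder, the value is irrelevant.) -/
def lump (ζ : Fin 3 → ℂ) (z : ℂ) : ℂ :=
  (numerator ζ).eval (Complex.exp z) / (denominator ζ).eval (Complex.exp z)

/-- The cylinder `Σ = ℂ / 2πiℤ`, cut open to the strip `-π < Im z ≤ π`, on which the area measure
of the flat metric `dx² + dy²` is Lebesgue measure. -/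
def cylinder : Set ℂ := {z | z.im ∈ Set.Ioc (-Real.pi) Real.pi}

/-- The variation of the lump `W_ζ` at `z` when `ζ` moves with velocity `X`. -/
def variation (ζ X : Fin 3 → ℂ) (z : ℂ) : ℂ :=
  deriv (fun t : ℝ => lump (ζ + (t : ℂ) • X) z) 0

/-- The pairing of two variations of `W_ζ` at `z` in the round metric
`4 |dW|² / (1 + |W|²)²` of the unit two-sphere. -/
def l2Density (ζ X Y : Fin 3 → ℂ) (z : ℂ) : ℝ :=
  4 * (variation ζ X z * (starRingEnd ℂ) (variation ζ Y z)).re / (1 + ‖lump ζ z‖ ^ 2) ^ 2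

/-- The `L²` metric `γ` on `M₂^∞`: `γ_ζ(X, X)` is twice the kinetic energy
`2 ∫_Σ |∂_t W|² / (1 + |W|²)²`. -/
def l2Metric (ζ X Y : Fin 3 → ℂ) : ℝ :=
  ∫ z in cylinder, l2Density ζ X Y z

/-! ### The surface `Ξ_∞` -/

/-- The coordinates of the lump `z ↦ (e^{-z} + α) / (e^z + α)`. -/
def xiInfty (α : ℂ) : Fin 3 → ℂ := ![α, α, 1]

theorem lump_xiInfty (α z : ℂ) :
    lump (xiInfty α) z = (Complex.exp (-z) + α) / (Complex.exp z + α) := by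
  have h : Complex.exp z ≠ 0 := Complex.exp_ne_zero z
  have h1 : (numerator (xiInfty α)).eval (Complex.exp z)
      = Complex.exp z * (Complex.exp (-z) + α) := by
    simp [numerator, xiInfty, mul_add, Complex.exp_neg, h]
    ring
  have h2 : (denominator (xiInfty α)).eval (Complex.exp z)
      = Complex.exp z * (Complex.exp z + α) := by
    simp [denominator, xiInfty]
    ring
  rw [lump, h1, h2, mul_div_mul_left _ _ h]

theorem xiInfty_mem_iff (α : ℂ) : xiInfty α ∈ moduliTwoInfty ↔ α ≠ 1 ∧ α ≠ -1 := by
  have key : xiInfty α ∈ moduliTwoInfty ↔ α ^ 2 ≠ 1 := by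
    constructor
    · rintro ⟨a, b, hab⟩ h
      have h' := congrArg (Polynomial.eval (-α)) hab
      simp [denominator, numerator, xiInfty] at h'
      have e1 : -(α * α) + 1 = 0 := by linear_combination -h
      have e2 : α ^ 2 + -(α * α) = 0 := by ring
      simp [e1, e2] at h'
    · intro h
      have h' : (1 - α ^ 2) ≠ 0 := fun h0 => h (by linear_combination -h0)
      refine ⟨Polynomial.C (α ^ 2 / (1 - α ^ 2)),
        1 - Polynomial.C (α / (1 - α ^ 2)) * Polynomial.X, ?_⟩
      apply Polynomial.funext
      intro r
      simp [denominator, numerator, xiInfty]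
      field_simp
      ring
  rw [key, Ne, sq_eq_one_iff, not_or]

/-- The point of `ℂ` with real coordinates `x`. -/
def toComplex (x : Fin 2 → ℝ) : ℂ := ⟨x 0, x 1⟩

/-- The real coordinates `(Re α, Im α)` of `α`. -/
def toReal (α : ℂ) : Fin 2 → ℝ := ![α.re, α.im]

/-- The domain `α ∈ ℂ ∖ {-1, 1}` of the global chart of `Ξ_∞`: the parameters whose map is a
point of `M₂^∞`. -/
def xiDomain : Set (Fin 2 → ℝ) := {x | xiInfty (toComplex x) ∈ moduliTwoInfty}

/-- The coordinate vector fields of `Ξ_∞ ⊂ M₂^∞` with respect to `(Re α, Im α)`. -/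
def xiTangent (x : Fin 2 → ℝ) (i : Fin 2) : Fin 3 → ℂ :=
  fderiv ℝ (fun y => xiInfty (toComplex y)) x (Pi.single i 1)

/-- The metric induced on `Ξ_∞` by the `L²` metric of `M₂^∞`, in the coordinates
`(Re α, Im α)`. -/
def xiMetric (x : Fin 2 → ℝ) : Matrix (Fin 2) (Fin 2) ℝ :=
  Matrix.of fun i j => l2Metric (xiInfty (toComplex x)) (xiTangent x i) (xiTangent x j)

/-! ### Scalar curvature in a chart -/

/-- The `i`-th partial derivative. -/
def partialDeriv {m : ℕ} (i : Fin m) (f : (Fin m → ℝ) → ℝ) (x : Fin m → ℝ) : ℝ :=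
  fderiv ℝ f x (Pi.single i 1)

/-- The Christoffel symbol `Γ^k_{ij}` of the metric `g`. -/
def christoffel {m : ℕ} (g : (Fin m → ℝ) → Matrix (Fin m) (Fin m) ℝ) (k i j : Fin m)
    (x : Fin m → ℝ) : ℝ :=
  (1 / 2) * ∑ l, (g x)⁻¹ k l *
    (partialDeriv i (fun y => g y j l) x + partialDeriv j (fun y => g y i l) x
      - partialDeriv l (fun y => g y i j) x)

/-- The Ricci tensor `∂_k Γ^k_{ij} - ∂_j Γ^k_{ik} + Γ^k_{kl} Γ^l_{ij} - Γ^k_{jl} Γ^l_{ik}`. -/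
def ricci {m : ℕ} (g : (Fin m → ℝ) → Matrix (Fin m) (Fin m) ℝ) (i j : Fin m)
    (x : Fin m → ℝ) : ℝ :=
  ∑ k, (partialDeriv k (christoffel g k i j) x - partialDeriv j (christoffel g k i k) x)
    + ∑ k, ∑ l, (christoffel g k k l x * christoffel g l i j x
      - christoffel g k j l x * christoffel g l i k x)

/-- The scalar curvature `g^{ij} Ric_{ij}` (for a surface, twice the Gauss curvature). -/
def scalarCurvature {m : ℕ} (g : (Fin m → ℝ) → Matrix (Fin m) (Fin m) ℝ)
    (x : Fin m → ℝ) : ℝ :=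
  ∑ i, ∑ j, (g x)⁻¹ i j * ricci g i j x

end Lump

end

namespace Lump

/-! ### Holomorphic changes of variables -/

/-! The maps depend holomorphically on `α`, so the induced metric is `F(α) |dα|²`. The heart of the
proof is that `F` depends on `α` only through `h = |1 - α²|`. With `C = cosh z`, the parallelogram
law turns the density into `|dC/dz|²` times a function of `C` (`xiDensity_eq`), and `cosh` maps each
half of the cylinder onto almost all of `ℂ`. The Möbius coordinate `C = (β e^ζ + 1)/(β e^ζ - 1)`
with `β = (1 - α)/(1 + α)` then gives (`radialDensity_eq`) `F = 8 J₀(h)`, `J_m(h) = ∫ c^m / (2 + h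
c)^(m+2)`, `c = cosh s + cos θ`, over the strip `ℝ × (-π, π]`.

Since `J_m' = -(m + 2) J_{m+1}`, the factor is smooth for `h > 0`. The curvature of `F |dα|²` is
`-Δ(log F)/F`, and because `1 - α²` is holomorphic with derivative of modulus `2|α|`, this becomes
(`scalarCurvature_radialFactor`) `R = |α|² (2 (h J₁)² + J₀ (h J₁ - 3 h² J₂)) / (h² J₀³)`.

As `h → 0` three estimates suffice: `h J₁` is bounded below (`le_mul_stripIntegral_one`), `J₀ ≤ 32π²
h^(-1/4)` (`stripIntegral_zero_le`), and `|h J₁ - 3 h² J₂| ≤ 3 h J₀`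
(`abs_dilation_stripIntegral_le`). The second numerator term is then `O(h J₀²) = O(h^(1/2))`, the
first stays positive, and the denominator is `O(h^(5/4))`, so `R → +∞`.

The third estimate is a scaling argument: `h J₁ - 3 h² J₂` is `h d/dh` of `h J₁`, and for large
`|s|` a dilation of `h` acts on `h c ≈ h e^|s| / 2` like a translation of `|s|`. The integrand is
therefore an `s`-derivative up to a small error. -/

theorem abs_det_restrictScalars_smulRight (c : ℂ) :
    |((ContinuousLinearMap.toSpanSingleton ℂ c).restrictScalars ℝ).det| = ‖c‖ ^ 2 := by
  have h : ((ContinuousLinearMap.toSpanSingleton ℂ c).restrictScalars ℝ).det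
      = LinearMap.det (LinearMap.mulLeft ℝ c) := by
    rw [ContinuousLinearMap.det]
    congr 1
    ext
    simp [mul_comm]
  have h2 : LinearMap.det (LinearMap.mulLeft ℝ c) = Complex.normSq c := by
    rw [← LinearMap.det_toMatrix Complex.basisOneI, Matrix.det_fin_two]
    simp [LinearMap.toMatrix_apply, Complex.normSq_apply]
  rw [h, h2, Complex.normSq_eq_norm_sq, abs_of_nonneg (by positivity)]

/-- The real Jacobian of a holomorphic map is `‖f'‖²`. An image of full measure is enough, which
lets the maps below miss null sets. -/
theorem integral_norm_deriv_sq_mul_comp {s : Set ℂ} {f f' : ℂ → ℂ} (hs : MeasurableSet s)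
    (hf : ∀ z ∈ s, HasDerivAt f (f' z) z) (hinj : Set.InjOn f s)
    (himg : f '' s =ᵐ[volume] (Set.univ : Set ℂ)) (g : ℂ → ℝ) :
    ∫ z in s, ‖f' z‖ ^ 2 * g (f z) = ∫ w, g w := by
  have := integral_image_eq_integral_abs_det_fderiv_smul (volume : Measure ℂ) hs
    (fun z hz => ((hf z hz).hasFDerivAt.restrictScalars ℝ).hasFDerivWithinAt) hinj g
  simp only [abs_det_restrictScalars_smulRight, smul_eq_mul] at this
  rw [← this, setIntegral_congr_set himg, setIntegral_univ]

theorem integrableOn_norm_deriv_sq_mul_comp_iff {s : Set ℂ} {f f' : ℂ → ℂ}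
    (hs : MeasurableSet s) (hf : ∀ z ∈ s, HasDerivAt f (f' z) z) (hinj : Set.InjOn f s)
    (himg : f '' s =ᵐ[volume] (Set.univ : Set ℂ)) (g : ℂ → ℝ) :
    IntegrableOn (fun z => ‖f' z‖ ^ 2 * g (f z)) s ↔ Integrable g := by
  have := integrableOn_image_iff_integrableOn_abs_det_fderiv_smul (volume : Measure ℂ) hs
    (fun z hz => ((hf z hz).hasFDerivAt.restrictScalars ℝ).hasFDerivWithinAt) hinj g
  simp only [abs_det_restrictScalars_smulRight, smul_eq_mul] at this
  rw [← this, integrableOn_congr_set_ae himg, integrableOn_univ]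

/-! ### The conformal factor as an integral over the sphere -/

/-- The density of the conformal factor of the induced metric on the cylinder. -/
noncomputable def xiDensity (α z : ℂ) : ℝ :=
  16 * ‖Complex.sinh z‖ ^ 2
    / (‖Complex.exp z + α‖ ^ 2 + ‖Complex.exp (-z) + α‖ ^ 2) ^ 2

/-- The density of the conformal factor in the coordinate `cosh z`. -/
noncomputable def sphereDensity (α C : ℂ) : ℝ :=
  (‖C + α‖ ^ 2 + ‖C ^ 2 - 1‖)⁻¹ ^ 2

/-- The density of the conformal factor in the coordinate `ζ` with
`(1 - α) e^ζ / (1 + α) = coth² (z / 2)`, where `h = |1 - α²|`. -/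
noncomputable def radialDensity (h : ℝ) (z : ℂ) : ℝ :=
  (2 + h * (Real.cosh z.re + Real.cos z.im))⁻¹ ^ 2

/-- The sum and difference of `e^z + α` and `e^{-z} + α` are `2 (cosh z + α)` and `2 sinh z`, so the
parallelogram law expresses the denominator through `cosh z`. The remaining `‖sinh z‖²` is the
Jacobian of `cosh`. -/
theorem xiDensity_eq (α z : ℂ) :
    xiDensity α z = ‖Complex.sinh z‖ ^ 2 * (4 * sphereDensity α (Complex.cosh z)) := by
  have h := parallelogram_law_with_norm ℝ (Complex.exp z + α) (Complex.exp (-z) + α)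
  have h1 : Complex.exp z + α + (Complex.exp (-z) + α) = 2 * (Complex.cosh z + α) := by
    rw [Complex.cosh]; ring
  have h2 : Complex.exp z + α - (Complex.exp (-z) + α) = 2 * Complex.sinh z := by
    rw [Complex.sinh]; ring
  have h3 : Complex.cosh z ^ 2 - 1 = Complex.sinh z ^ 2 := by
    rw [Complex.cosh_sq]; ring
  rw [h1, h2, norm_mul, norm_mul] at h
  have h4 : ‖Complex.exp z + α‖ ^ 2 + ‖Complex.exp (-z) + α‖ ^ 2
      = 2 * (‖Complex.cosh z + α‖ ^ 2 + ‖Complex.sinh z‖ ^ 2) := by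
    norm_num at h; linarith
  rw [xiDensity, sphereDensity, h3, norm_pow, h4, mul_pow, inv_pow, div_eq_mul_inv, mul_inv]
  ring

/-- The two halves `0 < σ Re z` of the cylinder. -/
def halfCylinder (σ : ℝ) : Set ℂ := {z | 0 < σ * z.re ∧ z.im ∈ Set.Ioo (-Real.pi) Real.pi}

theorem measurableSet_halfCylinder (σ : ℝ) : MeasurableSet (halfCylinder σ) :=
  (measurableSet_lt measurable_const (Complex.measurable_re.const_mul σ)).inter
    (Complex.measurable_im measurableSet_Ioo)

theorem injOn_exp_cylinder : Set.InjOn Complex.exp cylinder := fun _ ha _ hb h =>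
  Complex.exp_inj_of_neg_pi_lt_of_le_pi ha.1 ha.2 hb.1 hb.2 h

/-- Equal values of `cosh` force `e^a = e^b` or `e^a e^b = 1`; the latter gives `Re a = -Re b`,
impossible within one half. -/
theorem injOn_cosh_halfCylinder (σ : ℝ) : Set.InjOn Complex.cosh (halfCylinder σ) := by
  intro a ha b hb h
  have hA := Complex.exp_ne_zero a
  have hB := Complex.exp_ne_zero b
  rw [Complex.cosh, Complex.cosh, Complex.exp_neg, Complex.exp_neg] at h
  have key : (Complex.exp a - Complex.exp b) * (Complex.exp a * Complex.exp b - 1) = 0 := by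
    field_simp at h
    linear_combination h
  rcases mul_eq_zero.1 key with h1 | h1
  · exact injOn_exp_cylinder ⟨ha.2.1, ha.2.2.le⟩ ⟨hb.2.1, hb.2.2.le⟩ (sub_eq_zero.1 h1)
  · exfalso
    rw [← Complex.exp_add, sub_eq_zero] at h1
    have h2 := congrArg (‖·‖) h1
    simp only [Complex.norm_exp, norm_one, Real.exp_eq_one_iff, Complex.add_re] at h2
    have h3 : σ * (a.re + b.re) = 0 := by rw [h2, mul_zero]
    linarith [ha.1, hb.1]

theorem cosh_im (z : ℂ) : (Complex.cosh z).im = Real.sinh z.re * Real.sin z.im := by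
  conv_lhs => rw [← Complex.re_add_im z]
  rw [Complex.cosh_add, Complex.cosh_mul_I, Complex.sinh_mul_I, ← Complex.ofReal_cosh,
    ← Complex.ofReal_sinh, ← Complex.ofReal_cos, ← Complex.ofReal_sin]
  simp [-Complex.ofReal_cosh, -Complex.ofReal_sinh, -Complex.ofReal_cos, -Complex.ofReal_sin]

theorem volume_im_eq (c : ℝ) : volume {z : ℂ | z.im = c} = 0 := by
  have := Complex.volume_preserving_equiv_real_prod.measure_preimage
    (s := Set.univ ×ˢ {c}) (MeasurableSet.univ.prod (measurableSet_singleton c)).nullMeasurableSet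
  rw [Measure.volume_eq_prod, Measure.prod_prod] at this
  simp only [Real.volume_singleton, mul_zero] at this
  convert this using 2
  ext z
  simp

theorem volume_re_eq (c : ℝ) : volume {z : ℂ | z.re = c} = 0 := by
  have := Complex.volume_preserving_equiv_real_prod.measure_preimage
    (s := {c} ×ˢ Set.univ) ((measurableSet_singleton c).prod MeasurableSet.univ).nullMeasurableSet
  rw [Measure.volume_eq_prod, Measure.prod_prod] at this
  simp only [Real.volume_singleton, zero_mul] at this
  convert this using 2
  ext z
  simp

theorem image_cosh_halfCylinder {σ : ℝ} (hσ : σ ≠ 0) :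
    Complex.cosh '' halfCylinder σ =ᵐ[volume] (Set.univ : Set ℂ) := by
  refine eventuallyEq_univ.2 (mem_of_superset (measure_eq_zero_iff_ae_notMem.1 (volume_im_eq 0))
    fun C hC => ?_)
  obtain ⟨z, rfl⟩ : ∃ z, Complex.cosh z = C := by
    obtain ⟨z, hz⟩ := Complex.cos_surjective C
    exact ⟨z * Complex.I, by rw [Complex.cosh_mul_I, hz]⟩
  -- Passing to the principal logarithm moves the preimage into the strip. For non-real `C` it
  -- avoids `Re = 0` and `Im = π`, and evenness of `cosh` selects the required half.
  have hz : Complex.cosh (Complex.log (Complex.exp z)) = Complex.cosh z := by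
    rw [Complex.cosh, Complex.exp_neg, Complex.exp_log (Complex.exp_ne_zero z), Complex.cosh,
      Complex.exp_neg]
  set w := Complex.log (Complex.exp z) with hw
  have hC' : Real.sinh w.re * Real.sin w.im ≠ 0 := by
    rw [← cosh_im, hz]; exact hC
  have h1 : -Real.pi < w.im := Complex.neg_pi_lt_log_im _
  have h2 : w.im < Real.pi := by
    refine lt_of_le_of_ne (Complex.log_im_le_pi _) fun h => hC' ?_
    rw [h]; simp
  have h3 : w.re ≠ 0 := fun h => hC' (by rw [h]; simp)
  rcases lt_or_gt_of_ne (mul_ne_zero hσ h3) with h | h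
  · refine ⟨-w, ⟨?_, ?_⟩, by rw [Complex.cosh_neg, hz]⟩
    · simpa using h
    · constructor <;> simp <;> linarith
  · exact ⟨w, ⟨h, h1, h2⟩, hz⟩

theorem cylinder_ae_eq :
    cylinder =ᵐ[volume] (halfCylinder 1 ∪ halfCylinder (-1) : Set ℂ) := by
  have h1 := measure_eq_zero_iff_ae_notMem.1 (volume_im_eq Real.pi)
  have h2 := measure_eq_zero_iff_ae_notMem.1 (volume_re_eq 0)
  filter_upwards [h1, h2] with z hz1 hz2
  refine propext ⟨fun h => ?_, fun h => ?_⟩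
  · have h3 : z.im ∈ Set.Ioo (-Real.pi) Real.pi := ⟨h.1, lt_of_le_of_ne h.2 hz1⟩
    rcases lt_or_gt_of_ne hz2 with h4 | h4
    · right; exact ⟨by linarith, h3⟩
    · left; exact ⟨by linarith, h3⟩
  · rcases h with h | h <;> exact ⟨h.2.1, h.2.2.le⟩

theorem setIntegral_halfCylinder_xiDensity {σ : ℝ} (hσ : σ ≠ 0) (α : ℂ) :
    ∫ z in halfCylinder σ, xiDensity α z = 4 * ∫ C, sphereDensity α C := by
  simp only [xiDensity_eq]
  rw [integral_norm_deriv_sq_mul_comp (measurableSet_halfCylinder σ)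
    (fun z _ => Complex.hasDerivAt_cosh z) (injOn_cosh_halfCylinder σ)
    (image_cosh_halfCylinder hσ) (fun C => 4 * sphereDensity α C), integral_const_mul]

theorem integrableOn_halfCylinder_xiDensity {σ : ℝ} (hσ : σ ≠ 0) {α : ℂ}
    (h : Integrable (sphereDensity α)) : IntegrableOn (xiDensity α) (halfCylinder σ) := by
  have := (integrableOn_norm_deriv_sq_mul_comp_iff (measurableSet_halfCylinder σ)
    (fun z _ => Complex.hasDerivAt_cosh z) (injOn_cosh_halfCylinder σ)
    (image_cosh_halfCylinder hσ) (fun C => 4 * sphereDensity α C)).2 (h.const_mul 4)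
  simpa only [← xiDensity_eq] using this

theorem integrableOn_xiDensity_of_integrable {α : ℂ} (h : Integrable (sphereDensity α)) :
    IntegrableOn (xiDensity α) cylinder := by
  rw [integrableOn_congr_set_ae cylinder_ae_eq]
  exact (integrableOn_halfCylinder_xiDensity one_ne_zero h).union
    (integrableOn_halfCylinder_xiDensity (by norm_num) h)

theorem integral_xiDensity_eq_sphere {α : ℂ} (h : Integrable (sphereDensity α)) :
    ∫ z in cylinder, xiDensity α z = 8 * ∫ C, sphereDensity α C := by
  have hd : Disjoint (halfCylinder 1) (halfCylinder (-1)) :=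
    Set.disjoint_left.2 fun z h1 h2 => by linarith [h1.1, h2.1]
  rw [setIntegral_congr_set cylinder_ae_eq,
    setIntegral_union hd (measurableSet_halfCylinder _)
      (integrableOn_halfCylinder_xiDensity one_ne_zero h)
      (integrableOn_halfCylinder_xiDensity (by norm_num) h),
    setIntegral_halfCylinder_xiDensity one_ne_zero,
    setIntegral_halfCylinder_xiDensity (by norm_num)]
  ring

/-! ### The radial form of the conformal factor -/

theorem norm_exp_add_one_sq (z : ℂ) :
    ‖Complex.exp z + 1‖ ^ 2 = ‖Complex.exp z‖ * (2 * (Real.cosh z.re + Real.cos z.im)) := by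
  have h := Real.exp_pos z.re
  have h2 := Real.sin_sq_add_cos_sq z.im
  rw [← Complex.normSq_eq_norm_sq, Complex.normSq_apply, Complex.norm_exp, Real.cosh_eq,
    Real.exp_neg]
  simp only [Complex.add_re, Complex.add_im, Complex.exp_re, Complex.exp_im, Complex.one_re,
    Complex.one_im]
  field_simp
  linear_combination (Real.exp z.re) ^ 2 * h2

theorem measurableSet_cylinder : MeasurableSet cylinder :=
  Complex.measurable_im measurableSet_Ioc

/-- The Möbius map taking `e^ζ` to `cosh z`. -/
noncomputable def sphereCoord (β z : ℂ) : ℂ :=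
  (β * Complex.exp z + 1) / (β * Complex.exp z - 1)

/-- The cylinder without the point sent to infinity by `sphereCoord`. -/
def sphereCoordDomain (β : ℂ) : Set ℂ := cylinder ∩ {z | β * Complex.exp z ≠ 1}

theorem measurableSet_sphereCoordDomain (β : ℂ) : MeasurableSet (sphereCoordDomain β) :=
  measurableSet_cylinder.inter
    (((Complex.measurable_exp.const_mul β) (measurableSet_singleton 1)).compl)

theorem volume_cylinder_inter_exp_eq (c : ℂ) :
    volume (cylinder ∩ {z | Complex.exp z = c}) = 0 := by
  refine measure_mono_null (t := {Complex.log c}) ?_ (measure_singleton _)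
  rintro z ⟨hz, rfl⟩
  exact (Complex.log_exp hz.1 hz.2).symm

theorem sphereCoordDomain_ae_eq (β : ℂ) :
    sphereCoordDomain β =ᵐ[volume] cylinder := by
  have h := measure_eq_zero_iff_ae_notMem.1 (volume_cylinder_inter_exp_eq β⁻¹)
  filter_upwards [h] with z hz
  refine propext ⟨fun h => h.1, fun h => ⟨h, fun h2 => hz ⟨h, ?_⟩⟩⟩
  exact eq_inv_of_mul_eq_one_right h2

theorem hasDerivAt_sphereCoord {β z : ℂ} (hz : z ∈ sphereCoordDomain β) :
    HasDerivAt (sphereCoord β)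
      (-2 * (β * Complex.exp z) / (β * Complex.exp z - 1) ^ 2) z := by
  have h1 : HasDerivAt (fun z => β * Complex.exp z) (β * Complex.exp z) z :=
    (Complex.hasDerivAt_exp z).const_mul β
  have h := (h1.add_const 1).div (h1.sub_const 1) (sub_ne_zero.2 hz.2)
  refine h.congr_deriv ?_
  ring

theorem injOn_sphereCoord {β : ℂ} (hβ : β ≠ 0) :
    Set.InjOn (sphereCoord β) (sphereCoordDomain β) := by
  intro a ha b hb h
  have h1 := sub_ne_zero.2 ha.2
  have h2 := sub_ne_zero.2 hb.2
  refine injOn_exp_cylinder ha.1 hb.1 (mul_left_cancel₀ hβ ?_)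
  rw [sphereCoord, sphereCoord, div_eq_div_iff h1 h2] at h
  linear_combination (-1 / 2) * h

theorem image_sphereCoord {β : ℂ} (hβ : β ≠ 0) :
    sphereCoord β '' sphereCoordDomain β =ᵐ[volume] (Set.univ : Set ℂ) := by
  refine eventuallyEq_univ.2 (mem_of_superset (measure_eq_zero_iff_ae_notMem.1
    ((Set.toFinite {(1 : ℂ), -1}).measure_zero volume)) fun C hC => ?_)
  simp only [Set.mem_insert_iff, Set.mem_singleton_iff, not_or, Set.mem_ofPred_eq] at hC
  have h1 : C - 1 ≠ 0 := sub_ne_zero.2 hC.1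
  have h2 : C + 1 ≠ 0 := fun h => hC.2 (by linear_combination h)
  have h3 : β * Complex.exp (Complex.log ((C + 1) / (C - 1) / β)) = (C + 1) / (C - 1) := by
    rw [Complex.exp_log (div_ne_zero (div_ne_zero h2 h1) hβ)]
    field_simp
  refine ⟨Complex.log ((C + 1) / (C - 1) / β),
    ⟨⟨Complex.neg_pi_lt_log_im _, Complex.log_im_le_pi _⟩, ?_⟩, ?_⟩
  · rw [Set.mem_ofPred_eq, h3, Ne, div_eq_one_iff_eq h1]
    intro h
    have : (2 : ℂ) = 0 := by linear_combination h
    norm_num at this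
  · rw [sphereCoord, h3]
    have : (C + 1) / (C - 1) - 1 ≠ 0 := by
      rw [div_sub_one h1]
      exact div_ne_zero (by ring_nf; norm_num) h1
    rw [div_eq_iff this]
    field_simp
    ring

/-- The coordinate `e^ζ` puts the zeros `C = -1, 1` of `C² - 1` at `0, ∞`, and the constant `β` is
chosen so that `C = -α` goes to `e^ζ = -1`. Then `|C + α|²` contributes `|e^ζ + 1|²`, and `α`
survives only in `|1 + α| |1 - α|`. -/
theorem radialDensity_eq {α z : ℂ} (h1 : 1 + α ≠ 0) (h2 : 1 - α ≠ 0)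
    (hz : z ∈ sphereCoordDomain ((1 - α) / (1 + α))) :
    ‖-2 * ((1 - α) / (1 + α) * Complex.exp z)
        / ((1 - α) / (1 + α) * Complex.exp z - 1) ^ 2‖ ^ 2
      * sphereDensity α (sphereCoord ((1 - α) / (1 + α)) z) = radialDensity ‖1 - α ^ 2‖ z := by
  have hy := sub_ne_zero.2 hz.2
  set y := (1 - α) / (1 + α) * Complex.exp z with hydef
  have hE := Complex.exp_ne_zero z
  have hay : (1 + α) * y = (1 - α) * Complex.exp z := by
    rw [hydef]; field_simp
  have e1 : sphereCoord ((1 - α) / (1 + α)) z + α = (1 - α) * (Complex.exp z + 1) / (y - 1) := by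
    rw [sphereCoord, ← hydef, eq_div_iff hy, add_mul, div_mul_cancel₀ _ hy]
    linear_combination hay
  have e2 : sphereCoord ((1 - α) / (1 + α)) z ^ 2 - 1 = 4 * y / (y - 1) ^ 2 := by
    rw [sphereCoord, ← hydef]
    field_simp
    ring
  have e3 : ‖1 - α ^ 2‖ = ‖1 + α‖ * ‖1 - α‖ := by
    rw [← norm_mul]; congr 1; ring
  have e4 : ‖y‖ = ‖1 - α‖ / ‖1 + α‖ * ‖Complex.exp z‖ := by
    rw [hydef, norm_mul, norm_div]
  have n1 : 0 < ‖1 + α‖ := norm_pos_iff.2 h1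
  have n2 : 0 < ‖1 - α‖ := norm_pos_iff.2 h2
  have n3 : 0 < ‖Complex.exp z‖ := norm_pos_iff.2 hE
  have n4 : 0 < ‖y - 1‖ := norm_pos_iff.2 hy
  have n5 : 0 ≤ Real.cosh z.re + Real.cos z.im := by
    linarith [Real.one_le_cosh z.re, Real.neg_one_le_cos z.im]
  rw [sphereDensity, radialDensity, e1, e2, ← mul_pow]
  congr 1
  simp only [norm_mul, norm_div, norm_pow, norm_neg]
  rw [div_pow, mul_pow, norm_exp_add_one_sq, e3, e4]
  norm_num
  generalize Real.cosh z.re + Real.cos z.im = c at *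
  field_simp
  ring

theorem integral_sphereDensity_eq {α : ℂ} (h1 : 1 + α ≠ 0) (h2 : 1 - α ≠ 0) :
    ∫ C, sphereDensity α C = ∫ z in cylinder, radialDensity ‖1 - α ^ 2‖ z := by
  have hβ : (1 - α) / (1 + α) ≠ 0 := div_ne_zero h2 h1
  rw [← setIntegral_congr_set (sphereCoordDomain_ae_eq _),
    ← integral_norm_deriv_sq_mul_comp (measurableSet_sphereCoordDomain _)
      (fun z hz => hasDerivAt_sphereCoord hz) (injOn_sphereCoord hβ) (image_sphereCoord hβ)
      (sphereDensity α)]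
  exact setIntegral_congr_fun (measurableSet_sphereCoordDomain _)
    fun z hz => radialDensity_eq h1 h2 hz

theorem integrable_sphereDensity_iff {α : ℂ} (h1 : 1 + α ≠ 0) (h2 : 1 - α ≠ 0) :
    Integrable (sphereDensity α) ↔ IntegrableOn (radialDensity ‖1 - α ^ 2‖) cylinder := by
  have hβ : (1 - α) / (1 + α) ≠ 0 := div_ne_zero h2 h1
  rw [← integrableOn_congr_set_ae (sphereCoordDomain_ae_eq _),
    ← integrableOn_norm_deriv_sq_mul_comp_iff (measurableSet_sphereCoordDomain _)
      (fun z hz => hasDerivAt_sphereCoord hz) (injOn_sphereCoord hβ) (image_sphereCoord hβ)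
      (sphereDensity α)]
  exact integrableOn_congr_fun (fun z hz => radialDensity_eq h1 h2 hz)
    (measurableSet_sphereCoordDomain _)

/-! ### The induced metric is conformal to the flat metric -/

/-- The derivative of `α` with respect to its real and imaginary part. -/
def coordDirection : Fin 2 → ℂ := ![1, Complex.I]

theorem toComplex_single (i : Fin 2) : toComplex (Pi.single i 1) = coordDirection i := by
  fin_cases i <;> simp [toComplex, coordDirection, Complex.ext_iff]

/-- The derivative of `xiInfty ∘ toComplex`. -/
noncomputable def xiLinear : (Fin 2 → ℝ) →L[ℝ] (Fin 3 → ℂ) :=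
  LinearMap.toContinuousLinearMap
    { toFun := fun y => ![toComplex y, toComplex y, 0]
      map_add' := fun x y => by
        ext i; fin_cases i <;> simp [toComplex, Complex.ext_iff]
      map_smul' := fun c x => by
        ext i; fin_cases i <;> simp [toComplex, Complex.ext_iff] }

theorem xiTangent_eq (x : Fin 2 → ℝ) (i : Fin 2) :
    xiTangent x i = ![coordDirection i, coordDirection i, 0] := by
  have h : (fun y => xiInfty (toComplex y)) = fun y => xiLinear y + ![0, 0, 1] := by
    ext y i; fin_cases i <;> simp [xiInfty, xiLinear]
  rw [xiTangent, h, fderiv_add_const, ContinuousLinearMap.fderiv]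
  simp [xiLinear, toComplex_single]

theorem variation_xiInfty {α z : ℂ} (c : ℂ) (hz : Complex.exp z + α ≠ 0) :
    variation (xiInfty α) ![c, c, 0] z
      = c * (2 * Complex.sinh z / (Complex.exp z + α) ^ 2) := by
  have hE := Complex.exp_ne_zero z
  have hl : (fun t : ℝ => lump (xiInfty α + (t : ℂ) • ![c, c, 0]) z)
      = fun t : ℝ => ((α + t * c) * Complex.exp z + 1)
        / (Complex.exp z ^ 2 + (α + t * c) * Complex.exp z) := by
    ext t
    simp [lump, numerator, denominator, xiInfty]
  have hp : HasDerivAt (fun t : ℝ => (α + t * c) * Complex.exp z) (c * Complex.exp z) 0 := by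
    have := ((Complex.ofRealCLM.hasDerivAt (x := (0 : ℝ))).mul_const c).const_add α
    simpa using this.mul_const (Complex.exp z)
  have hD : Complex.exp z ^ 2 + (α + ((0 : ℝ) : ℂ) * c) * Complex.exp z ≠ 0 := by
    have : Complex.exp z ^ 2 + (α + ((0 : ℝ) : ℂ) * c) * Complex.exp z
        = Complex.exp z * (Complex.exp z + α) := by
      push_cast; ring
    rw [this]
    exact mul_ne_zero hE hz
  have h := (hp.add_const 1).div (hp.const_add (Complex.exp z ^ 2)) hD
  rw [variation, hl]
  refine h.deriv.trans ?_
  have hs : 2 * Complex.sinh z = (Complex.exp z ^ 2 - 1) / Complex.exp z := by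
    rw [Complex.sinh, Complex.exp_neg]
    field_simp
  rw [hs]
  have hD' : Complex.exp z ^ 2 + α * Complex.exp z ≠ 0 := by simpa using hD
  push_cast
  simp only [zero_mul, add_zero]
  field_simp
  ring

theorem coordDirection_inner (i j : Fin 2) :
    (coordDirection i * (starRingEnd ℂ) (coordDirection j)).re
      = (1 : Matrix (Fin 2) (Fin 2) ℝ) i j := by
  fin_cases i <;> fin_cases j <;> simp [coordDirection]

theorem l2Density_xi {x : Fin 2 → ℝ} {z : ℂ} (i j : Fin 2)
    (hz : Complex.exp z + toComplex x ≠ 0) :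
    l2Density (xiInfty (toComplex x)) (xiTangent x i) (xiTangent x j) z
      = (1 : Matrix (Fin 2) (Fin 2) ℝ) i j * xiDensity (toComplex x) z := by
  rw [l2Density, xiTangent_eq, xiTangent_eq, variation_xiInfty _ hz, variation_xiInfty _ hz,
    lump_xiInfty, xiDensity, ← coordDirection_inner]
  set v := 2 * Complex.sinh z / (Complex.exp z + toComplex x) ^ 2 with hv
  have h1 : coordDirection i * v * (starRingEnd ℂ) (coordDirection j * v)
      = ((‖v‖ ^ 2 : ℝ) : ℂ) * (coordDirection i * (starRingEnd ℂ) (coordDirection j)) := by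
    have := Complex.mul_conj v
    rw [Complex.normSq_eq_norm_sq] at this
    rw [map_mul, ← this]
    ring
  rw [h1, Complex.re_ofReal_mul, hv]
  have n1 : 0 < ‖Complex.exp z + toComplex x‖ := norm_pos_iff.2 hz
  simp only [norm_mul, norm_div, norm_pow]
  norm_num
  field_simp
  ring

theorem l2Density_xi_ae (x : Fin 2 → ℝ) (i j : Fin 2) :
    l2Density (xiInfty (toComplex x)) (xiTangent x i) (xiTangent x j)
      =ᵐ[volume.restrict cylinder]
        fun z => (1 : Matrix (Fin 2) (Fin 2) ℝ) i j * xiDensity (toComplex x) z := by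
  rw [EventuallyEq, ae_restrict_iff' measurableSet_cylinder]
  -- The poles `e^z = -α` are discarded: there the quotient takes a default value.
  have h := measure_eq_zero_iff_ae_notMem.1 (volume_cylinder_inter_exp_eq (-toComplex x))
  filter_upwards [h] with z hz hc
  exact l2Density_xi i j fun h0 => hz ⟨hc, eq_neg_of_add_eq_zero_left h0⟩

/-- By holomorphy in `α` the two coordinate variations are `1` and `i` times one common function,
hence pointwise orthogonal and of equal length. -/
theorem xiMetric_eq (x : Fin 2 → ℝ) :
    xiMetric x = (∫ z in cylinder, xiDensity (toComplex x) z) • 1 := by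
  ext i j
  rw [xiMetric, Matrix.of_apply, l2Metric, integral_congr_ae (l2Density_xi_ae x i j),
    integral_const_mul, Matrix.smul_apply, smul_eq_mul, mul_comm]

theorem integrableOn_l2Density_xi {x : Fin 2 → ℝ}
    (h : IntegrableOn (xiDensity (toComplex x)) cylinder) (i j : Fin 2) :
    IntegrableOn (l2Density (xiInfty (toComplex x)) (xiTangent x i) (xiTangent x j)) cylinder :=
  (Integrable.const_mul h _).congr (l2Density_xi_ae x i j).symm

/-! ### Stieltjes-type integrals depending on a parameter -/

/-- The integrals `∫ c^m / (2 + h c)^(m+2) dμ`. -/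
noncomputable def stieltjes {X : Type*} [MeasurableSpace X] (μ : Measure X) (c : X → ℝ) (m : ℕ)
    (h : ℝ) : ℝ :=
  ∫ x, c x ^ m * (2 + h * c x)⁻¹ ^ (m + 2) ∂μ

/-- Since `c / (2 + a c) ≤ 1/a`, each integrand is dominated, uniformly for `h ≥ a`, by a multiple
of the one with `m = 0`. This gives both integrability and differentiation under the integral. -/
theorem pow_mul_inv_pow_le {a h c : ℝ} (ha : 0 < a) (hah : a ≤ h) (hc : 0 ≤ c) (m : ℕ) :
    c ^ m * (2 + h * c)⁻¹ ^ (m + 2) ≤ a⁻¹ ^ m * (2 + a * c)⁻¹ ^ 2 := by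
  have h0 : 0 < 2 + a * c := by positivity
  have h1 : 2 + a * c ≤ 2 + h * c := by gcongr
  have h2 : (2 + h * c)⁻¹ ≤ (2 + a * c)⁻¹ := inv_anti₀ h0 h1
  have h3 : 0 < (2 + h * c)⁻¹ := inv_pos.2 (h0.trans_le h1)
  have h4 : c * (2 + a * c)⁻¹ ≤ a⁻¹ := by
    rw [← div_eq_mul_inv, div_le_iff₀ h0]
    field_simp
    linarith
  calc c ^ m * (2 + h * c)⁻¹ ^ (m + 2) ≤ c ^ m * (2 + a * c)⁻¹ ^ (m + 2) := by gcongr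
    _ = (c * (2 + a * c)⁻¹) ^ m * (2 + a * c)⁻¹ ^ 2 := by ring
    _ ≤ a⁻¹ ^ m * (2 + a * c)⁻¹ ^ 2 := by gcongr

section Stieltjes

variable {X : Type*} [MeasurableSpace X] {μ : Measure X} {c : X → ℝ}

theorem integrable_stieltjes (hcm : Measurable c) (hc : ∀ x, 0 ≤ c x)
    (hint : ∀ h, 0 < h → Integrable (fun x => (2 + h * c x)⁻¹ ^ 2) μ) (m : ℕ) {h : ℝ}
    (hh : 0 < h) : Integrable (fun x => c x ^ m * (2 + h * c x)⁻¹ ^ (m + 2)) μ := by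
  refine ((hint h hh).const_mul (h⁻¹ ^ m)).mono' (by fun_prop) (ae_of_all _ fun x => ?_)
  have := hc x
  rw [Real.norm_of_nonneg (by positivity)]
  exact pow_mul_inv_pow_le hh le_rfl (hc x) m

theorem hasDerivAt_stieltjes (hcm : Measurable c) (hc : ∀ x, 0 ≤ c x)
    (hint : ∀ h, 0 < h → Integrable (fun x => (2 + h * c x)⁻¹ ^ 2) μ) (m : ℕ) {h : ℝ}
    (hh : 0 < h) :
    HasDerivAt (stieltjes μ c m) (-(m + 2) * stieltjes μ c (m + 1) h) h := by
  have hd : ∀ a, ∀ x ∈ Set.Ioi (h / 2),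
      HasDerivAt (fun x => c a ^ m * (2 + x * c a)⁻¹ ^ (m + 2))
        (-(m + 2) * (c a ^ (m + 1) * (2 + x * c a)⁻¹ ^ (m + 1 + 2))) x := by
    intro a x hx
    have hx' : 0 < x := lt_trans (by positivity) (Set.mem_Ioi.1 hx)
    have h0 : 2 + x * c a ≠ 0 := by have := hc a; positivity
    have h1 := ((((hasDerivAt_id x).mul_const (c a)).const_add 2).inv h0).pow (m + 2)
    refine (h1.const_mul (c a ^ m)).congr_deriv ?_
    simp only [id, Pi.inv_apply, Nat.add_succ_sub_one, Nat.cast_add, Nat.cast_ofNat, one_mul,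
      div_eq_mul_inv, ← inv_pow]
    ring
  have h := hasDerivAt_integral_of_dominated_loc_of_deriv_le (μ := μ)
    (F := fun h x => c x ^ m * (2 + h * c x)⁻¹ ^ (m + 2))
    (F' := fun h x => -(m + 2) * (c x ^ (m + 1) * (2 + h * c x)⁻¹ ^ (m + 1 + 2)))
    (bound := fun x => (m + 2) * ((h / 2)⁻¹ ^ (m + 1) * (2 + h / 2 * c x)⁻¹ ^ 2))
    (Ioi_mem_nhds (half_lt_self hh))
    (Eventually.of_forall fun y => by fun_prop)
    (integrable_stieltjes hcm hc hint m hh) (by fun_prop)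
    (ae_of_all _ fun a x hx => by
      have hx' : 0 < x := lt_trans (by positivity) (Set.mem_Ioi.1 hx)
      have := hc a
      rw [norm_mul, norm_neg, Real.norm_of_nonneg (by positivity),
        Real.norm_of_nonneg (by positivity)]
      exact mul_le_mul_of_nonneg_left
        (pow_mul_inv_pow_le (half_pos hh) (le_of_lt hx) (hc a) (m + 1)) (by positivity))
    (((hint _ (half_pos hh)).const_mul _).const_mul _) (ae_of_all _ hd)
  refine h.2.congr_deriv ?_
  rw [integral_const_mul, stieltjes]

theorem contDiffOn_stieltjes (hcm : Measurable c) (hc : ∀ x, 0 ≤ c x)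
    (hint : ∀ h, 0 < h → Integrable (fun x => (2 + h * c x)⁻¹ ^ 2) μ) (n m : ℕ) :
    ContDiffOn ℝ n (stieltjes μ c m) (Set.Ioi 0) := by
  -- Differentiation replaces `m` by `m + 1`, so the induction must cover all `m` at once.
  induction n generalizing m with
  | zero =>
    exact contDiffOn_zero.2 fun h hh =>
      (hasDerivAt_stieltjes hcm hc hint m hh).continuousAt.continuousWithinAt
  | succ n ih =>
    push_cast
    rw [contDiffOn_succ_iff_deriv_of_isOpen isOpen_Ioi]
    refine ⟨fun h hh =>
      (hasDerivAt_stieltjes hcm hc hint m hh).differentiableAt.differentiableWithinAt,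
      fun h => absurd h (by simp), ?_⟩
    exact (contDiffOn_const.mul (ih (m + 1))).congr fun h hh =>
      (hasDerivAt_stieltjes hcm hc hint m hh).deriv

end Stieltjes

/-! ### The strip -/

theorem sqrt_sqrt_pow_four {h : ℝ} (hh : 0 ≤ h) : √(√h) ^ 4 = h := by
  rw [show (4 : ℕ) = 2 * 2 from rfl, pow_mul, Real.sq_sqrt (Real.sqrt_nonneg h), Real.sq_sqrt hh]

theorem exists_pow_four_eq {h : ℝ} (hh : 0 < h) : ∃ k, 0 < k ∧ k ^ 4 = h :=
  ⟨√(√h), Real.sqrt_pos.2 (Real.sqrt_pos.2 hh), sqrt_sqrt_pow_four hh.le⟩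

/-- The area measure of the cylinder, in real coordinates. -/
noncomputable def stripMeasure : Measure (ℝ × ℝ) :=
  (volume : Measure ℝ).prod (volume.restrict (Set.Ioc (-Real.pi) Real.pi))

/-- The function `cosh s + cos θ`. -/
noncomputable def stripHeight (p : ℝ × ℝ) : ℝ := Real.cosh p.1 + Real.cos p.2

theorem measurePreserving_cylinder :
    MeasurePreserving Complex.measurableEquivRealProd (volume.restrict cylinder)
      stripMeasure := by
  have h := Complex.volume_preserving_equiv_real_prod.restrict_preimage
    (s := Set.univ ×ˢ Set.Ioc (-Real.pi) Real.pi) (MeasurableSet.univ.prod measurableSet_Ioc)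
  rw [Measure.volume_eq_prod, ← Measure.prod_restrict, Measure.restrict_univ] at h
  have hc : cylinder
      = Complex.measurableEquivRealProd ⁻¹' Set.univ ×ˢ Set.Ioc (-Real.pi) Real.pi := by
    ext z
    simp [cylinder]
  rw [hc]
  exact h

theorem measurable_stripHeight : Measurable stripHeight := by
  unfold stripHeight; fun_prop

theorem stripHeight_nonneg (p : ℝ × ℝ) : 0 ≤ stripHeight p := by
  rw [stripHeight]
  linarith [Real.one_le_cosh p.1, Real.neg_one_le_cos p.2]

theorem one_add_pow_four_le_cosh (s : ℝ) : 1 + s ^ 4 / 24 ≤ Real.cosh s := by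
  have h := sum_le_hasSum (Finset.range 3)
    (fun n _ => by rw [pow_mul]; positivity) (Real.hasSum_cosh s)
  simp only [Finset.sum_range_succ, Finset.sum_range_zero, Nat.factorial] at h
  norm_num at h
  nlinarith [sq_nonneg s]

/-- Writing `h = k⁴` matches the quartic bound `cosh s ≥ 1 + s⁴/24`, whose `1` absorbs `cos θ ≥ -1`.
The result is a Lorentzian in `k s` with integral of order `1/k = h^(-1/4)`; this crude growth rate
is all that the limit needs. -/
theorem inv_stripHeight_sq_le {k : ℝ} (p : ℝ × ℝ) :
    (2 + k ^ 4 * stripHeight p)⁻¹ ^ 2 ≤ 16 * (1 + (k * p.1) ^ 2)⁻¹ := by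
  have h1 : p.1 ^ 4 / 24 ≤ stripHeight p := by
    rw [stripHeight]
    linarith [one_add_pow_four_le_cosh p.1, Real.neg_one_le_cos p.2]
  have h2 : (1 + (k * p.1) ^ 2) / 4 ≤ 2 + k ^ 4 * stripHeight p := by
    have : k ^ 4 * (p.1 ^ 4 / 24) ≤ k ^ 4 * stripHeight p := by gcongr
    nlinarith [sq_nonneg ((k * p.1) ^ 2 - 3)]
  have h3 : (2 + k ^ 4 * stripHeight p)⁻¹ ≤ ((1 + (k * p.1) ^ 2) / 4)⁻¹ :=
    inv_anti₀ (by positivity) h2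
  have h4 : 0 ≤ 2 + k ^ 4 * stripHeight p := by
    have := stripHeight_nonneg p
    positivity
  have h5 : (1 + (k * p.1) ^ 2)⁻¹ ≤ 1 := inv_le_one_of_one_le₀ (by nlinarith [sq_nonneg (k * p.1)])
  calc (2 + k ^ 4 * stripHeight p)⁻¹ ^ 2 ≤ ((1 + (k * p.1) ^ 2) / 4)⁻¹ ^ 2 := by gcongr
    _ = 16 * ((1 + (k * p.1) ^ 2)⁻¹ * (1 + (k * p.1) ^ 2)⁻¹) := by rw [inv_div]; ring
    _ ≤ 16 * ((1 + (k * p.1) ^ 2)⁻¹ * 1) := by gcongr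
    _ = _ := by ring

theorem integrable_strip_lorentzian {k : ℝ} (hk : 0 < k) :
    Integrable (fun p : ℝ × ℝ => 16 * (1 + (k * p.1) ^ 2)⁻¹) stripMeasure := by
  have h := (integrable_inv_one_add_sq.comp_mul_left' hk.ne').const_mul 16
  exact h.comp_fst _

theorem integral_strip_lorentzian {k : ℝ} (hk : 0 < k) :
    ∫ p : ℝ × ℝ, 16 * (1 + (k * p.1) ^ 2)⁻¹ ∂stripMeasure = 32 * Real.pi ^ 2 / k := by
  rw [stripMeasure, integral_prod _ (integrable_strip_lorentzian hk)]
  simp only [integral_const, smul_eq_mul]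
  rw [integral_const_mul, integral_const_mul,
    Measure.integral_comp_mul_left (fun s : ℝ => (1 + s ^ 2)⁻¹) k, integral_univ_inv_one_add_sq,
    abs_of_pos (inv_pos.2 hk)]
  simp [Measure.real, Real.volume_Ioc]
  rw [ENNReal.toReal_ofReal (by positivity)]
  field_simp
  ring

theorem integrable_inv_stripHeight_sq {h : ℝ} (hh : 0 < h) :
    Integrable (fun p => (2 + h * stripHeight p)⁻¹ ^ 2) stripMeasure := by
  obtain ⟨k, hk, rfl⟩ := exists_pow_four_eq hh
  have hm := measurable_stripHeight
  refine (integrable_strip_lorentzian hk).mono' (by fun_prop) (ae_of_all _ fun p => ?_)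
  rw [Real.norm_of_nonneg (by positivity)]
  exact inv_stripHeight_sq_le p

/-- The integrals `∫ c^m / (2 + h c)^(m+2)` over the cylinder, with `c = cosh s + cos θ`. -/
noncomputable def stripIntegral (m : ℕ) (h : ℝ) : ℝ := stieltjes stripMeasure stripHeight m h

theorem integrable_stripIntegral (m : ℕ) {h : ℝ} (hh : 0 < h) :
    Integrable (fun p => stripHeight p ^ m * (2 + h * stripHeight p)⁻¹ ^ (m + 2)) stripMeasure :=
  integrable_stieltjes measurable_stripHeight stripHeight_nonneg
    (fun _ => integrable_inv_stripHeight_sq) m hh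

theorem hasDerivAt_stripIntegral (m : ℕ) {h : ℝ} (hh : 0 < h) :
    HasDerivAt (stripIntegral m) (-(m + 2) * stripIntegral (m + 1) h) h :=
  hasDerivAt_stieltjes measurable_stripHeight stripHeight_nonneg
    (fun _ => integrable_inv_stripHeight_sq) m hh

theorem contDiffOn_stripIntegral (n m : ℕ) :
    ContDiffOn ℝ n (stripIntegral m) (Set.Ioi 0) :=
  contDiffOn_stieltjes measurable_stripHeight stripHeight_nonneg
    (fun _ => integrable_inv_stripHeight_sq) n m

theorem stripIntegral_zero (h : ℝ) :
    stripIntegral 0 h = ∫ p, (2 + h * stripHeight p)⁻¹ ^ 2 ∂stripMeasure := by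
  simp [stripIntegral, stieltjes]

theorem stripIntegral_zero_le {k : ℝ} (hk : 0 < k) :
    stripIntegral 0 (k ^ 4) ≤ 32 * Real.pi ^ 2 / k := by
  rw [stripIntegral_zero, ← integral_strip_lorentzian hk]
  exact integral_mono (integrable_inv_stripHeight_sq (by positivity))
    (integrable_strip_lorentzian hk) fun p => inv_stripHeight_sq_le p

theorem integrableOn_radialDensity {h : ℝ} (hh : 0 < h) :
    IntegrableOn (radialDensity h) cylinder :=
  measurePreserving_cylinder.integrable_comp_of_integrable (integrable_inv_stripHeight_sq hh)

theorem integral_radialDensity (h : ℝ) :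
    ∫ z in cylinder, radialDensity h z = stripIntegral 0 h := by
  rw [stripIntegral_zero]
  exact measurePreserving_cylinder.integral_comp' (fun p => (2 + h * stripHeight p)⁻¹ ^ 2)

theorem stripIntegral_zero_pos {h : ℝ} (hh : 0 < h) : 0 < stripIntegral 0 h := by
  rw [stripIntegral_zero, integral_pos_iff_support_of_nonneg (fun p => by positivity)
    (integrable_inv_stripHeight_sq hh)]
  have : Function.support (fun p => (2 + h * stripHeight p)⁻¹ ^ 2) = Set.univ := by
    refine Set.eq_univ_of_forall fun p => ?_
    have := stripHeight_nonneg p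
    rw [Function.mem_support]
    positivity
  rw [this, stripMeasure, ← Set.univ_prod_univ, Measure.prod_prod]
  simp [Real.pi_pos]

/-! ### Asymptotics of the strip integrals at zero -/

/-- The mass of the integrand sits where `h c` is of order one. On `log(4/h) ≤ s ≤ log(4/h) + 1` one
has `1 ≤ h c ≤ 13`, so the integrand is at least `15⁻³ = 1/3375`, and the box has area `2π ≥ 1`. -/
theorem le_mul_stripIntegral_one {h : ℝ} (hh : 0 < h) (h1 : h ≤ 1) :
    1 / 3375 ≤ h * stripIntegral 1 h := by
  set L := Real.log (4 / h) with hL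
  have hexp : Real.exp L = 4 / h := Real.exp_log (by positivity)
  set S : Set (ℝ × ℝ) := Set.Icc L (L + 1) ×ˢ Set.univ with hS
  have hSm : MeasurableSet S := measurableSet_Icc.prod MeasurableSet.univ
  have hSv : stripMeasure S = ENNReal.ofReal (2 * Real.pi) := by
    rw [hS, stripMeasure, Measure.prod_prod]
    simp [Real.volume_Icc, Real.volume_Ioc]
    rw [← two_mul, ENNReal.ofReal_mul zero_le_two]
    simp
  have hint := (integrable_stripIntegral 1 hh).const_mul h
  have hbound : ∀ p ∈ S, 1 / 3375
      ≤ h * (stripHeight p ^ 1 * (2 + h * stripHeight p)⁻¹ ^ (1 + 2)) := by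
    intro p hp
    have hp1 : L ≤ p.1 ∧ p.1 ≤ L + 1 := hp.1
    have hpos := Real.exp_pos p.1
    have e1 : 4 / h ≤ Real.exp p.1 := hexp ▸ Real.exp_le_exp.2 hp1.1
    have e2 : Real.exp p.1 ≤ 4 / h * 3 := by
      calc Real.exp p.1 ≤ Real.exp (L + 1) := Real.exp_le_exp.2 hp1.2
        _ = 4 / h * Real.exp 1 := by rw [Real.exp_add, hexp]
        _ ≤ 4 / h * 3 := by gcongr; linarith [Real.exp_one_lt_d9]
    have e3 : 4 ≤ h * Real.exp p.1 := by
      rw [div_le_iff₀ hh] at e1; linarith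
    have e4 : h * Real.exp p.1 ≤ 12 := by
      have := mul_le_mul_of_nonneg_left e2 hh.le
      rwa [show h * (4 / h * 3) = 12 by field_simp; norm_num] at this
    have e5 : Real.exp (-p.1) ≤ Real.exp p.1 := by
      refine Real.exp_le_exp.2 ?_
      have : 0 ≤ L := Real.log_nonneg (by rw [le_div_iff₀ hh]; linarith)
      linarith
    have e6 := Real.exp_pos (-p.1)
    have l1 : 1 ≤ h * stripHeight p := by
      rw [stripHeight, Real.cosh_eq]
      nlinarith [Real.neg_one_le_cos p.2]
    have l2 : h * stripHeight p ≤ 13 := by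
      rw [stripHeight, Real.cosh_eq]
      nlinarith [Real.cos_le_one p.2]
    have l3 : (15 : ℝ)⁻¹ ≤ (2 + h * stripHeight p)⁻¹ :=
      inv_anti₀ (by linarith) (by linarith)
    calc (1 / 3375 : ℝ) = 1 * (15 : ℝ)⁻¹ ^ 3 := by norm_num
      _ ≤ h * stripHeight p * (2 + h * stripHeight p)⁻¹ ^ 3 := by gcongr
      _ = _ := by ring
  have hnn : ∀ p, 0 ≤ h * (stripHeight p ^ 1 * (2 + h * stripHeight p)⁻¹ ^ (1 + 2)) := by
    intro p
    have := stripHeight_nonneg p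
    positivity
  calc (1 / 3375 : ℝ) ≤ 1 / 3375 * stripMeasure.real S := by
        rw [Measure.real, hSv, ENNReal.toReal_ofReal (by positivity)]
        linarith [Real.pi_gt_three]
    _ ≤ ∫ p in S, h * (stripHeight p ^ 1 * (2 + h * stripHeight p)⁻¹ ^ (1 + 2)) ∂stripMeasure :=
        setIntegral_ge_of_const_le_real hSm (by rw [hSv]; exact ENNReal.ofReal_ne_top) hbound
          hint.integrableOn
    _ ≤ ∫ p, h * (stripHeight p ^ 1 * (2 + h * stripHeight p)⁻¹ ^ (1 + 2)) ∂stripMeasure :=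
        setIntegral_le_integral hint (ae_of_all _ hnn)
    _ = h * stripIntegral 1 h := by rw [integral_const_mul]; rfl

/-- The `s`-derivative of `x / (2 + x)³ * tanh s`, where `x = h (cosh s + cos θ)`. -/
noncomputable def stripDivergence (h : ℝ) (p : ℝ × ℝ) : ℝ :=
  h * Real.sinh p.1 * (2 - 2 * (h * stripHeight p)) * (2 + h * stripHeight p)⁻¹ ^ 4
      * (Real.sinh p.1 / Real.cosh p.1)
    + h * stripHeight p * (2 + h * stripHeight p)⁻¹ ^ 3 * (1 / Real.cosh p.1 ^ 2)

theorem hasDerivAt_stripDivergence {h : ℝ} (hh : 0 < h) (θ s : ℝ) :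
    HasDerivAt (fun s => h * stripHeight (s, θ) * (2 + h * stripHeight (s, θ))⁻¹ ^ 3
      * (Real.sinh s / Real.cosh s)) (stripDivergence h (s, θ)) s := by
  have hc := stripHeight_nonneg (s, θ)
  have h0 : 2 + h * stripHeight (s, θ) ≠ 0 := by positivity
  have hx : HasDerivAt (fun s => h * stripHeight (s, θ)) (h * Real.sinh s) s :=
    ((Real.hasDerivAt_cosh s).add_const (Real.cos θ)).const_mul h
  have ht := (Real.hasDerivAt_sinh s).div (Real.hasDerivAt_cosh s) (Real.cosh_pos s).ne'
  have hi := ((hx.const_add 2).inv h0).pow 3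
  have hcs := Real.cosh_sq s
  have hcs' : Real.cosh s * Real.cosh s - Real.sinh s * Real.sinh s = 1 := by linarith
  refine ((hx.mul hi).mul ht).congr_deriv ?_
  rw [stripDivergence]
  simp only [Pi.mul_apply, Pi.pow_apply, Pi.inv_apply, Pi.div_apply, hcs']
  have hcp := (Real.cosh_pos s).ne'
  generalize stripHeight (s, θ) = c at *
  push_cast
  field_simp
  ring

theorem mul_inv_cube_le {x : ℝ} (hx : 0 ≤ x) : x * (2 + x)⁻¹ ^ 3 ≤ (2 + x)⁻¹ ^ 2 := by
  have h1 : x * (2 + x)⁻¹ ≤ 1 := by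
    rw [← div_eq_mul_inv, div_le_one (by positivity)]; linarith
  calc x * (2 + x)⁻¹ ^ 3 = x * (2 + x)⁻¹ * (2 + x)⁻¹ ^ 2 := by ring
    _ ≤ 1 * (2 + x)⁻¹ ^ 2 := by gcongr
    _ = _ := one_mul _

theorem abs_sinh_div_cosh_le (s : ℝ) : |Real.sinh s / Real.cosh s| ≤ 1 := by
  rw [abs_div, abs_of_pos (Real.cosh_pos s), div_le_one (Real.cosh_pos s)]
  refine abs_le_of_sq_le_sq ?_ (Real.cosh_pos s).le
  rw [Real.cosh_sq]
  linarith

theorem tendsto_lorentzian {k : ℝ} (hk : 0 < k) {l : Filter ℝ}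
    (hl : Tendsto (fun s : ℝ => |s|) l atTop) :
    Tendsto (fun s : ℝ => 16 * (1 + (k * s) ^ 2)⁻¹) l (𝓝 0) := by
  have h1 : Tendsto (fun s : ℝ => 1 + (k * s) ^ 2) l atTop := by
    refine tendsto_atTop_add_const_left _ _ ?_
    have h2 : Tendsto (fun s : ℝ => (k * |s|) ^ 2) l atTop :=
      (tendsto_pow_atTop two_ne_zero).comp (hl.const_mul_atTop hk)
    refine h2.congr fun s => ?_
    rw [mul_pow, mul_pow, sq_abs]
  simpa using h1.inv_tendsto_atTop.const_mul 16

theorem tendsto_stripFlux {h : ℝ} (hh : 0 < h) (θ : ℝ) {l : Filter ℝ}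
    (hl : Tendsto (fun s : ℝ => |s|) l atTop) :
    Tendsto (fun s => h * stripHeight (s, θ) * (2 + h * stripHeight (s, θ))⁻¹ ^ 3
      * (Real.sinh s / Real.cosh s)) l (𝓝 0) := by
  obtain ⟨k, hk, rfl⟩ := exists_pow_four_eq hh
  refine squeeze_zero_norm (fun s => ?_) (tendsto_lorentzian hk hl)
  have hc := stripHeight_nonneg (s, θ)
  have hx : 0 ≤ k ^ 4 * stripHeight (s, θ) := by positivity
  rw [norm_mul, Real.norm_of_nonneg (by positivity), Real.norm_eq_abs]
  calc _ ≤ (2 + k ^ 4 * stripHeight (s, θ))⁻¹ ^ 2 * 1 :=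
        mul_le_mul (mul_inv_cube_le hx) (abs_sinh_div_cosh_le s) (abs_nonneg _)
          (by positivity)
    _ ≤ _ := by rw [mul_one]; exact inv_stripHeight_sq_le (s, θ)

/-- The integrand of `h J₁ - 3 h² J₂`. -/
noncomputable def stripDilation (h : ℝ) (p : ℝ × ℝ) : ℝ :=
  h * (stripHeight p ^ 1 * (2 + h * stripHeight p)⁻¹ ^ (1 + 2))
    - 3 * h ^ 2 * (stripHeight p ^ 2 * (2 + h * stripHeight p)⁻¹ ^ (2 + 2))

/-- With `x = h c`, the dilation integrand is `x (2 - 2x)/(2 + x)⁴`, while the `s`-derivative of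
`x/(2 + x)³` carries `h sinh s` in place of `x`. The factor `tanh s` repairs this, as `sinh s tanh s
= cosh s - 1/cosh s`. What is left are the bounded terms `cos θ + 1/cosh s` and the derivative
`1/cosh² s` of `tanh`. -/
theorem abs_stripDilation_sub_stripDivergence_le {h : ℝ} (hh : 0 < h) (p : ℝ × ℝ) :
    |stripDilation h p - stripDivergence h p| ≤ 3 * h * (2 + h * stripHeight p)⁻¹ ^ 2 := by
  have hc := stripHeight_nonneg p
  have hC := Real.one_le_cosh p.1
  have hCp := Real.cosh_pos p.1
  set u := 1 / Real.cosh p.1 with hu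
  have hu0 : 0 < u := by positivity
  have hu1 : u ≤ 1 := by rw [hu, div_le_one hCp]; exact hC
  set i := (2 + h * stripHeight p)⁻¹ with hi
  have hi0 : 0 < i := by positivity
  have hci : (2 + h * stripHeight p) * i = 1 := mul_inv_cancel₀ (by positivity)
  have hsc : Real.sinh p.1 * (Real.sinh p.1 / Real.cosh p.1) = Real.cosh p.1 - u := by
    have := Real.cosh_sq p.1
    rw [hu]
    field_simp
    linarith
  have hcu : stripHeight p * u ^ 2 ≤ 2 := by
    have h1 : stripHeight p ≤ 2 * Real.cosh p.1 := by
      rw [stripHeight]; linarith [Real.cos_le_one p.2]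
    have h2 : Real.cosh p.1 * u = 1 := by rw [hu]; field_simp
    calc stripHeight p * u ^ 2 ≤ 2 * Real.cosh p.1 * u ^ 2 := by gcongr
      _ = 2 * (Real.cosh p.1 * u) * u := by ring
      _ ≤ 2 := by rw [h2]; linarith
  have key : stripDilation h p - stripDivergence h p
      = h * (Real.cos p.2 + u) * ((2 - 2 * (h * stripHeight p)) * i ^ 2) * i ^ 2
        - h * (stripHeight p * u ^ 2) * i * i ^ 2 := by
    have e1 : stripDilation h p
        = h * stripHeight p * (2 - 2 * (h * stripHeight p)) * i ^ 4 := by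
      have : stripDilation h p = h * stripHeight p * i ^ 3 * ((2 + h * stripHeight p) * i)
          - 3 * h ^ 2 * (stripHeight p ^ 2 * i ^ 4) := by
        rw [hci, stripDilation]; ring
      rw [this]; ring
    have e2 : stripDivergence h p
        = h * (Real.cosh p.1 - u) * (2 - 2 * (h * stripHeight p)) * i ^ 4
          + h * stripHeight p * i ^ 3 * u ^ 2 := by
      rw [stripDivergence, ← hsc, hu]; ring
    have e3 : stripHeight p = Real.cosh p.1 + Real.cos p.2 := rfl
    rw [e1, e2]
    linear_combination h * (2 - 2 * (h * stripHeight p)) * i ^ 4 * e3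
  have b1 : |Real.cos p.2 + u| ≤ 2 :=
    abs_le.2 ⟨by linarith [Real.neg_one_le_cos p.2], by linarith [Real.cos_le_one p.2]⟩
  have hx0 : 0 ≤ h * stripHeight p := by positivity
  generalize h * stripHeight p = x at hx0 hci key
  -- Everything is now a polynomial in `i = 1/(2 + x)`, which lies in `(0, 1/2]`.
  have hxi : x * i = 1 - 2 * i := by linear_combination hci
  have hi2 : i ≤ 1 / 2 := by nlinarith
  have b2 : |(2 - 2 * x) * i ^ 2| ≤ 1 := by
    have : (2 - 2 * x) * i ^ 2 = 2 * i * (3 * i - 1) := by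
      linear_combination (-2 * i) * hxi
    rw [this, abs_le]
    constructor <;> nlinarith
  have b3 : |h * (stripHeight p * u ^ 2) * i| ≤ h := by
    rw [abs_of_nonneg (by positivity)]
    have : stripHeight p * u ^ 2 * i ≤ 2 * (1 / 2) := by gcongr
    nlinarith
  have b4 : |h * (Real.cos p.2 + u) * ((2 - 2 * x) * i ^ 2)| ≤ h * 2 * 1 := by
    rw [abs_mul, abs_mul, abs_of_pos hh]
    gcongr
  rw [key, ← sub_mul, abs_mul, abs_of_pos (pow_pos hi0 2)]
  refine mul_le_mul_of_nonneg_right ?_ (by positivity)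
  exact (abs_sub _ _).trans (by linarith)

theorem integrable_stripDilation {h : ℝ} (hh : 0 < h) :
    Integrable (stripDilation h) stripMeasure :=
  ((integrable_stripIntegral 1 hh).const_mul h).sub
    ((integrable_stripIntegral 2 hh).const_mul (3 * h ^ 2))

theorem integral_stripDilation {h : ℝ} (hh : 0 < h) :
    ∫ p, stripDilation h p ∂stripMeasure
      = h * stripIntegral 1 h - 3 * h ^ 2 * stripIntegral 2 h := by
  unfold stripDilation
  rw [integral_sub ((integrable_stripIntegral 1 hh).const_mul h)
    ((integrable_stripIntegral 2 hh).const_mul (3 * h ^ 2)), integral_const_mul,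
    integral_const_mul]
  rfl

theorem integrable_stripDilation_sub {h : ℝ} (hh : 0 < h) :
    Integrable (fun p => stripDilation h p - stripDivergence h p) stripMeasure := by
  have hm := measurable_stripHeight
  refine ((integrable_inv_stripHeight_sq hh).const_mul (3 * h)).mono' ?_
    (ae_of_all _ fun p => abs_stripDilation_sub_stripDivergence_le hh p)
  unfold stripDilation stripDivergence
  exact Measurable.aestronglyMeasurable (by fun_prop)

theorem integrable_stripDivergence {h : ℝ} (hh : 0 < h) :
    Integrable (stripDivergence h) stripMeasure := by
  refine ((integrable_stripDilation hh).sub (integrable_stripDilation_sub hh)).congr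
    (ae_of_all _ fun p => ?_)
  simp

/-- On almost every line `θ = const` the integral is the difference of the flux at `s = ±∞`, and the
flux vanishes at both ends. -/
theorem integral_stripDivergence {h : ℝ} (hh : 0 < h) :
    ∫ p, stripDivergence h p ∂stripMeasure = 0 := by
  have hi := integrable_stripDivergence hh
  rw [stripMeasure] at hi ⊢
  rw [integral_prod_symm _ hi]
  refine integral_eq_zero_of_ae ?_
  filter_upwards [hi.prod_left_ae] with θ hθ
  have := integral_of_hasDerivAt_of_tendsto (fun s => hasDerivAt_stripDivergence hh θ s) hθ
    (tendsto_stripFlux hh θ tendsto_abs_atBot_atTop)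
    (tendsto_stripFlux hh θ tendsto_abs_atTop_atTop)
  simpa using this

theorem abs_dilation_stripIntegral_le {h : ℝ} (hh : 0 < h) :
    |h * stripIntegral 1 h - 3 * h ^ 2 * stripIntegral 2 h| ≤ 3 * h * stripIntegral 0 h := by
  have h1 : h * stripIntegral 1 h - 3 * h ^ 2 * stripIntegral 2 h
      = ∫ p, (stripDilation h p - stripDivergence h p) ∂stripMeasure := by
    rw [integral_sub (integrable_stripDilation hh) (integrable_stripDivergence hh),
      integral_stripDivergence hh, integral_stripDilation hh, sub_zero]
  rw [h1, stripIntegral_zero, ← integral_const_mul]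
  exact (norm_integral_le_integral_norm _).trans (integral_mono
    (integrable_stripDilation_sub hh).norm ((integrable_inv_stripHeight_sq hh).const_mul _)
    fun p => abs_stripDilation_sub_stripDivergence_le hh p)

/-! ### The scalar curvature of a conformally flat surface -/

theorem inv_smul_one_fin_two (a : ℝ) :
    (a • (1 : Matrix (Fin 2) (Fin 2) ℝ))⁻¹ = a⁻¹ • 1 := by
  -- At `a = 0` both inverses are `0` by convention, so the Christoffel formula holds as an identity
  -- of functions and can be differentiated.
  rcases eq_or_ne a 0 with rfl | ha
  · simp
  · refine Matrix.inv_eq_right_inv ?_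
    rw [smul_mul_smul_comm, mul_inv_cancel₀ ha, one_smul, one_mul]

theorem partialDeriv_smul_one (F : (Fin 2 → ℝ) → ℝ) (i j l : Fin 2) (x : Fin 2 → ℝ) :
    partialDeriv i (fun y => (F y • (1 : Matrix (Fin 2) (Fin 2) ℝ)) j l) x
      = (1 : Matrix (Fin 2) (Fin 2) ℝ) j l * partialDeriv i F x := by
  rcases eq_or_ne j l with rfl | h
  · simp [partialDeriv]
  · simp [partialDeriv, h]

theorem christoffel_smul_one (F : (Fin 2 → ℝ) → ℝ) (k i j : Fin 2) :
    christoffel (fun y => F y • (1 : Matrix (Fin 2) (Fin 2) ℝ)) k i j = fun y =>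
      (2 * F y)⁻¹ * ((1 : Matrix (Fin 2) (Fin 2) ℝ) j k * partialDeriv i F y
        + (1 : Matrix (Fin 2) (Fin 2) ℝ) i k * partialDeriv j F y
        - (1 : Matrix (Fin 2) (Fin 2) ℝ) i j * partialDeriv k F y) := by
  ext y
  rw [christoffel]
  simp only [partialDeriv_smul_one, inv_smul_one_fin_two]
  obtain rfl | rfl : k = 0 ∨ k = 1 := by omega
  all_goals
    simp
    ring

theorem partialDeriv_inv_mul {F G : (Fin 2 → ℝ) → ℝ} {x : Fin 2 → ℝ} (l : Fin 2)
    (hF : DifferentiableAt ℝ F x) (hG : DifferentiableAt ℝ G x) (h0 : F x ≠ 0) :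
    partialDeriv l (fun y => (2 * F y)⁻¹ * G y) x
      = (2 * F x)⁻¹ * partialDeriv l G x - partialDeriv l F x / (2 * F x ^ 2) * G x := by
  have h1 := (hasDerivAt_inv (mul_ne_zero two_ne_zero h0)).comp_hasFDerivAt x
    (hF.hasFDerivAt.const_mul 2)
  have h : HasFDerivAt (fun y => (2 * F y)⁻¹ * G y) _ x := h1.mul hG.hasFDerivAt
  rw [partialDeriv, h.fderiv]
  simp [partialDeriv]
  field_simp
  ring

theorem partialDeriv_lin_comb {P Q S : (Fin 2 → ℝ) → ℝ} {x : Fin 2 → ℝ} (l : Fin 2)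
    (hP : DifferentiableAt ℝ P x) (hQ : DifferentiableAt ℝ Q x) (hS : DifferentiableAt ℝ S x)
    (a b c : ℝ) :
    partialDeriv l (fun y => a * P y + b * Q y - c * S y) x
      = a * partialDeriv l P x + b * partialDeriv l Q x - c * partialDeriv l S x := by
  have h : HasFDerivAt (fun y => a * P y + b * Q y - c * S y) _ x :=
    ((hP.hasFDerivAt.const_mul a).add (hQ.hasFDerivAt.const_mul b)).sub
      (hS.hasFDerivAt.const_mul c)
  rw [partialDeriv, h.fderiv]
  simp [partialDeriv]

/-- This is `-Δ(log F)/F` with the logarithm expanded. -/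
theorem scalarCurvature_smul_one {F : (Fin 2 → ℝ) → ℝ} {x : Fin 2 → ℝ}
    (hF : DifferentiableAt ℝ F x) (hF' : ∀ i, DifferentiableAt ℝ (partialDeriv i F) x)
    (h0 : F x ≠ 0) :
    scalarCurvature (fun y => F y • (1 : Matrix (Fin 2) (Fin 2) ℝ)) x
      = (partialDeriv 0 F x ^ 2 + partialDeriv 1 F x ^ 2
        - F x * (partialDeriv 0 (partialDeriv 0 F) x + partialDeriv 1 (partialDeriv 1 F) x))
          / F x ^ 3 := by
  have hd : ∀ k i j l : Fin 2, partialDeriv l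
      (christoffel (fun y => F y • (1 : Matrix (Fin 2) (Fin 2) ℝ)) k i j) x
      = (2 * F x)⁻¹ * ((1 : Matrix (Fin 2) (Fin 2) ℝ) j k * partialDeriv l (partialDeriv i F) x
        + (1 : Matrix (Fin 2) (Fin 2) ℝ) i k * partialDeriv l (partialDeriv j F) x
        - (1 : Matrix (Fin 2) (Fin 2) ℝ) i j * partialDeriv l (partialDeriv k F) x)
        - partialDeriv l F x / (2 * F x ^ 2)
          * ((1 : Matrix (Fin 2) (Fin 2) ℝ) j k * partialDeriv i F x
        + (1 : Matrix (Fin 2) (Fin 2) ℝ) i k * partialDeriv j F x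
        - (1 : Matrix (Fin 2) (Fin 2) ℝ) i j * partialDeriv k F x) := by
    intro k i j l
    have hG : DifferentiableAt ℝ (fun y => (1 : Matrix (Fin 2) (Fin 2) ℝ) j k * partialDeriv i F y
        + (1 : Matrix (Fin 2) (Fin 2) ℝ) i k * partialDeriv j F y
        - (1 : Matrix (Fin 2) (Fin 2) ℝ) i j * partialDeriv k F y) x :=
      (((hF' i).const_mul _).add ((hF' j).const_mul _)).sub ((hF' k).const_mul _)
    rw [christoffel_smul_one, partialDeriv_inv_mul l hF hG h0,
      partialDeriv_lin_comb l (hF' i) (hF' j) (hF' k)]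
  simp only [scalarCurvature, ricci, hd]
  simp only [inv_smul_one_fin_two, christoffel_smul_one,
    Fin.sum_univ_two, Matrix.smul_apply, Matrix.one_apply]
  simp
  field_simp
  ring

theorem partialDeriv_congr {f g : (Fin 2 → ℝ) → ℝ} {x : Fin 2 → ℝ} (i : Fin 2)
    (h : f =ᶠ[𝓝 x] g) : partialDeriv i f x = partialDeriv i g x := by
  rw [partialDeriv, partialDeriv, h.fderiv_eq]

/-! ### The conformal factor in the chart -/

/-- The function `|1 - α²|²` in the coordinates `(Re α, Im α)`. -/
def discSq (x : Fin 2 → ℝ) : ℝ := (1 - x 0 ^ 2 + x 1 ^ 2) ^ 2 + (2 * (x 0 * x 1)) ^ 2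

theorem discSq_eq (x : Fin 2 → ℝ) : discSq x = ‖1 - toComplex x ^ 2‖ ^ 2 := by
  rw [← Complex.normSq_eq_norm_sq, Complex.normSq_apply]
  simp [discSq, toComplex, pow_two]
  ring

/-- The partial derivatives of `discSq`. -/
def discSqDeriv : Fin 2 → (Fin 2 → ℝ) → ℝ :=
  ![fun x => -4 * x 0 * (1 - x 0 ^ 2 - x 1 ^ 2), fun x => 4 * x 1 * (1 + x 0 ^ 2 + x 1 ^ 2)]

theorem differentiableAt_discSq (x : Fin 2 → ℝ) : DifferentiableAt ℝ discSq x := by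
  unfold discSq; fun_prop

theorem partialDeriv_discSq (i : Fin 2) (x : Fin 2 → ℝ) :
    partialDeriv i discSq x = discSqDeriv i x := by
  have h0 := hasFDerivAt_apply (𝕜 := ℝ) (F' := fun _ : Fin 2 => ℝ) 0 x
  have h1 := hasFDerivAt_apply (𝕜 := ℝ) (F' := fun _ : Fin 2 => ℝ) 1 x
  have h := ((((h0.pow 2).const_sub 1).add (h1.pow 2)).pow 2).add
    (((h0.mul h1).const_mul 2).pow 2)
  have h' : HasFDerivAt discSq _ x := h
  rw [partialDeriv, h'.fderiv]
  fin_cases i <;> simp [discSqDeriv] <;> ring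

theorem differentiableAt_discSqDeriv (i : Fin 2) (x : Fin 2 → ℝ) :
    DifferentiableAt ℝ (discSqDeriv i) x := by
  fin_cases i <;> simp only [discSqDeriv, Fin.zero_eta, Fin.mk_one, Matrix.cons_val_zero,
    Matrix.cons_val_one] <;> fun_prop

/-- For holomorphic `f = 1 - α²` one has `Δ|f|² = 4|f'|²` and `|∇|f|²|² = 4|f|²|f'|²`, with `|f'|² =
4|α|²`. This and `discSqDeriv_sq_add` make `|α|²` factor out of the curvature. -/
theorem laplacian_discSq (x : Fin 2 → ℝ) :
    partialDeriv 0 (discSqDeriv 0) x + partialDeriv 1 (discSqDeriv 1) x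
      = 16 * (x 0 ^ 2 + x 1 ^ 2) := by
  have h0 := hasFDerivAt_apply (𝕜 := ℝ) (F' := fun _ : Fin 2 => ℝ) 0 x
  have h1 := hasFDerivAt_apply (𝕜 := ℝ) (F' := fun _ : Fin 2 => ℝ) 1 x
  have e0 : HasFDerivAt (discSqDeriv 0) _ x :=
    (h0.const_mul (-4)).mul (((h0.pow 2).const_sub 1).sub (h1.pow 2))
  have e1 : HasFDerivAt (discSqDeriv 1) _ x :=
    (h1.const_mul 4).mul (((h0.pow 2).const_add 1).add (h1.pow 2))
  rw [partialDeriv, partialDeriv, e0.fderiv, e1.fderiv]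
  simp
  ring

theorem discSqDeriv_sq_add (x : Fin 2 → ℝ) :
    discSqDeriv 0 x ^ 2 + discSqDeriv 1 x ^ 2 = 16 * (x 0 ^ 2 + x 1 ^ 2) * discSq x := by
  simp [discSqDeriv, discSq]
  ring

theorem partialDeriv_comp {f : ℝ → ℝ} {f' : ℝ} {N : (Fin 2 → ℝ) → ℝ} {x : Fin 2 → ℝ}
    (i : Fin 2) (hf : HasDerivAt f f' (N x)) (hN : DifferentiableAt ℝ N x) :
    partialDeriv i (fun y => f (N y)) x = f' * partialDeriv i N x := by
  have h : HasFDerivAt (fun y => f (N y)) _ x := hf.comp_hasFDerivAt x hN.hasFDerivAt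
  rw [partialDeriv, h.fderiv]
  simp [partialDeriv]

theorem partialDeriv_mul {f g : (Fin 2 → ℝ) → ℝ} {x : Fin 2 → ℝ} (i : Fin 2)
    (hf : DifferentiableAt ℝ f x) (hg : DifferentiableAt ℝ g x) :
    partialDeriv i (fun y => f y * g y) x
      = partialDeriv i f x * g x + f x * partialDeriv i g x := by
  have h : HasFDerivAt (fun y => f y * g y) _ x := hf.hasFDerivAt.mul hg.hasFDerivAt
  rw [partialDeriv, h.fderiv]
  simp [partialDeriv]
  ring

/-- The conformal factor of `Ξ_∞`, as a function of `|1 - α²|²`. -/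
noncomputable def radialFactor (p : ℝ) : ℝ := 8 * stripIntegral 0 (√p)

/-- The derivative of `radialFactor`. -/
noncomputable def radialFactorDeriv (p : ℝ) : ℝ := -8 * stripIntegral 1 (√p) * (√p)⁻¹

theorem hasDerivAt_radialFactor {p : ℝ} (hp : 0 < p) :
    HasDerivAt radialFactor (radialFactorDeriv p) p := by
  have hs := Real.sqrt_pos.2 hp
  have h := ((hasDerivAt_stripIntegral 0 hs).comp p (Real.hasDerivAt_sqrt hp.ne')).const_mul 8
  refine h.congr_deriv ?_
  rw [radialFactorDeriv]
  push_cast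
  field_simp
  ring

theorem hasDerivAt_radialFactorDeriv {p : ℝ} (hp : 0 < p) :
    HasDerivAt radialFactorDeriv
      (12 * stripIntegral 2 (√p) / √p ^ 2 + 4 * stripIntegral 1 (√p) / √p ^ 3) p := by
  have hs := Real.sqrt_pos.2 hp
  have hd := Real.hasDerivAt_sqrt hp.ne'
  have h := (((hasDerivAt_stripIntegral 1 hs).comp p hd).const_mul (-8)).mul
    (hd.inv hs.ne')
  refine h.congr_deriv ?_
  simp only [Function.comp_apply, Pi.inv_apply]
  push_cast
  field_simp
  ring

/-- `G` is prescribed only on the open set `discSq > 0`; curvature depends on the germ at `x`, so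
this suffices. -/
theorem scalarCurvature_radialFactor {G : (Fin 2 → ℝ) → ℝ} {x : Fin 2 → ℝ}
    (hx : 0 < discSq x) (hG : ∀ y, 0 < discSq y → G y = radialFactor (discSq y)) :
    scalarCurvature (fun y => G y • (1 : Matrix (Fin 2) (Fin 2) ℝ)) x
      = (x 0 ^ 2 + x 1 ^ 2) * ((2 * (√(discSq x) * stripIntegral 1 √(discSq x)) ^ 2
          + stripIntegral 0 √(discSq x) * (√(discSq x) * stripIntegral 1 √(discSq x)
            - 3 * √(discSq x) ^ 2 * stripIntegral 2 √(discSq x)))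
        / (√(discSq x) ^ 2 * stripIntegral 0 √(discSq x) ^ 3)) := by
  have hU : ∀ y, 0 < discSq y → ∀ᶠ z in 𝓝 y, 0 < discSq z := fun y hy =>
    (differentiableAt_discSq y).continuousAt.eventually (lt_mem_nhds hy)
  have hG1 : ∀ y, 0 < discSq y → G =ᶠ[𝓝 y] fun z => radialFactor (discSq z) := fun y hy =>
    (hU y hy).mono fun z hz => hG z hz
  have hP : ∀ i, ∀ y, 0 < discSq y →
      partialDeriv i G y = radialFactorDeriv (discSq y) * discSqDeriv i y := by
    intro i y hy
    rw [partialDeriv_congr i (hG1 y hy),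
      partialDeriv_comp i (hasDerivAt_radialFactor hy) (differentiableAt_discSq y),
      partialDeriv_discSq]
  have hP1 : ∀ i, partialDeriv i G
      =ᶠ[𝓝 x] fun y => radialFactorDeriv (discSq y) * discSqDeriv i y := fun i =>
    (hU x hx).mono fun z hz => hP i z hz
  have hf1 : DifferentiableAt ℝ (fun y => radialFactorDeriv (discSq y)) x :=
    (hasDerivAt_radialFactorDeriv hx).differentiableAt.comp x (differentiableAt_discSq x)
  have hPP : ∀ i, partialDeriv i (partialDeriv i G) x
      = (12 * stripIntegral 2 √(discSq x) / √(discSq x) ^ 2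
          + 4 * stripIntegral 1 √(discSq x) / √(discSq x) ^ 3) * discSqDeriv i x ^ 2
        + radialFactorDeriv (discSq x) * partialDeriv i (discSqDeriv i) x := by
    intro i
    rw [partialDeriv_congr i (hP1 i), partialDeriv_mul i hf1 (differentiableAt_discSqDeriv i x),
      partialDeriv_comp i (hasDerivAt_radialFactorDeriv hx) (differentiableAt_discSq x),
      partialDeriv_discSq]
    ring
  have hGd : DifferentiableAt ℝ G x :=
    ((hasDerivAt_radialFactor hx).differentiableAt.comp x
      (differentiableAt_discSq x)).congr_of_eventuallyEq (hG1 x hx)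
  have hGd' : ∀ i, DifferentiableAt ℝ (partialDeriv i G) x := fun i =>
    (hf1.mul (differentiableAt_discSqDeriv i x)).congr_of_eventuallyEq (hP1 i)
  have hs : 0 < √(discSq x) := Real.sqrt_pos.2 hx
  have hJ := stripIntegral_zero_pos hs
  have hG0 : G x = 8 * stripIntegral 0 √(discSq x) := hG x hx
  rw [scalarCurvature_smul_one hGd hGd' (by rw [hG0]; positivity), hPP, hPP, hP _ _ hx,
    hP _ _ hx, hG0, radialFactorDeriv]
  have hgrad := discSqDeriv_sq_add x
  have hlap := laplacian_discSq x
  rw [← Real.sq_sqrt hx.le] at hgrad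
  generalize √(discSq x) = r at *
  generalize stripIntegral 0 r = J₀ at *
  generalize stripIntegral 1 r = J₁ at *
  generalize stripIntegral 2 r = J₂ at *
  rw [div_eq_iff (by positivity)]
  -- Here `A` and `B` stand for the first and second derivatives of `radialFactor`, and `D` for its
  -- value.
  have e : ∀ A B D : ℝ, (A * discSqDeriv 0 x) ^ 2 + (A * discSqDeriv 1 x) ^ 2
      - D * (B * discSqDeriv 0 x ^ 2 + A * partialDeriv 0 (discSqDeriv 0) x
        + (B * discSqDeriv 1 x ^ 2 + A * partialDeriv 1 (discSqDeriv 1) x))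
      = (A ^ 2 - D * B) * (16 * (x 0 ^ 2 + x 1 ^ 2) * r ^ 2)
        - D * A * (16 * (x 0 ^ 2 + x 1 ^ 2)) := by
    intro A B D
    linear_combination (A ^ 2 - D * B) * hgrad - D * A * hlap
  rw [e]
  field_simp
  ring

/-! ### The limit of the curvature -/

theorem tendsto_radialCurvature : Tendsto (fun h : ℝ =>
    (2 * (h * stripIntegral 1 h) ^ 2 + stripIntegral 0 h
      * (h * stripIntegral 1 h - 3 * h ^ 2 * stripIntegral 2 h))
        / (h ^ 2 * stripIntegral 0 h ^ 3)) (𝓝[>] 0) atTop := by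
  set B := 32 * Real.pi ^ 2 with hB
  have hBpos : 0 < B := by positivity
  set c : ℝ := (1 / 3375) ^ 2 with hc
  have hk0 : Tendsto (fun h : ℝ => √(√h)) (𝓝[>] 0) (𝓝[>] 0) := by
    refine tendsto_nhdsWithin_iff.2 ⟨?_, ?_⟩
    · have : Tendsto (fun h : ℝ => √(√h)) (𝓝 0) (𝓝 (√(√0))) :=
        (Real.continuous_sqrt.comp Real.continuous_sqrt).tendsto 0
      simpa using this.mono_left nhdsWithin_le_nhds
    · filter_upwards [self_mem_nhdsWithin] with h hh
      exact Real.sqrt_pos.2 (Real.sqrt_pos.2 hh)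
  have hlow : Tendsto (fun k : ℝ => c / B ^ 3 * (k ^ 5)⁻¹) (𝓝[>] 0) atTop := by
    refine Tendsto.const_mul_atTop (by positivity) (tendsto_inv_nhdsGT_zero.comp ?_)
    refine tendsto_nhdsWithin_iff.2 ⟨?_, ?_⟩
    · have : Tendsto (fun k : ℝ => k ^ 5) (𝓝 0) (𝓝 (0 ^ 5)) := (continuous_pow 5).tendsto 0
      simpa using this.mono_left nhdsWithin_le_nhds
    · filter_upwards [self_mem_nhdsWithin] with k hk
      exact pow_pos (Set.mem_Ioi.1 hk) 5
  have hsmall : ∀ᶠ k : ℝ in 𝓝[>] 0, 3 * B ^ 2 * k ^ 2 < c := by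
    have : Tendsto (fun k : ℝ => 3 * B ^ 2 * k ^ 2) (𝓝 0) (𝓝 (3 * B ^ 2 * 0 ^ 2)) :=
      Continuous.tendsto (by fun_prop) 0
    refine (this.mono_left nhdsWithin_le_nhds).eventually_lt_const ?_
    rw [hc]; norm_num
  have hle1 : ∀ᶠ h : ℝ in 𝓝[>] 0, h < 1 :=
    mem_nhdsWithin_of_mem_nhds (Iio_mem_nhds one_pos)
  refine tendsto_atTop_mono' _ ?_ (hlow.comp hk0)
  filter_upwards [hk0.eventually hsmall, hle1, self_mem_nhdsWithin] with h hk h1 hh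
  rw [Set.mem_Ioi] at hh
  have hkpos : 0 < √(√h) := Real.sqrt_pos.2 (Real.sqrt_pos.2 hh)
  have hk4 : √(√h) ^ 4 = h := sqrt_sqrt_pow_four hh.le
  rw [Function.comp_apply]
  generalize √(√h) = k at *
  have hJ := stripIntegral_zero_pos hh
  have hJ1 := le_mul_stripIntegral_one hh h1.le
  have hJ2 := (abs_le.1 (abs_dilation_stripIntegral_le hh)).1
  have hJ0 : stripIntegral 0 h ≤ B / k := by
    rw [← hk4]; exact stripIntegral_zero_le hkpos
  have hsq : c ≤ (h * stripIntegral 1 h) ^ 2 := by rw [hc]; gcongr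
  -- The possibly negative term of the numerator is at most `3 h J₀² ≤ 3 B² k²` in size, so it uses
  -- up at most one of the two copies of `c` supplied by `2 (h J₁)²`.
  have hq : 3 * h * stripIntegral 0 h ^ 2 ≤ c := by
    calc 3 * h * stripIntegral 0 h ^ 2 ≤ 3 * h * (B / k) ^ 2 := by gcongr
      _ = 3 * B ^ 2 * k ^ 2 := by rw [← hk4]; field_simp
      _ ≤ c := hk.le
  have hnum : c ≤ 2 * (h * stripIntegral 1 h) ^ 2 + stripIntegral 0 h
      * (h * stripIntegral 1 h - 3 * h ^ 2 * stripIntegral 2 h) := by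
    have := mul_le_mul_of_nonneg_left hJ2 hJ.le
    nlinarith
  have hden : h ^ 2 * stripIntegral 0 h ^ 3 ≤ B ^ 3 * k ^ 5 := by
    calc h ^ 2 * stripIntegral 0 h ^ 3 ≤ h ^ 2 * (B / k) ^ 3 := by gcongr
      _ = B ^ 3 * k ^ 5 := by rw [← hk4]; field_simp
  calc c / B ^ 3 * (k ^ 5)⁻¹ = c / (B ^ 3 * k ^ 5) := by field_simp
    _ ≤ c / (h ^ 2 * stripIntegral 0 h ^ 3) :=
        div_le_div_of_nonneg_left (by positivity) (by positivity) hden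
    _ ≤ _ := div_le_div_of_nonneg_right hnum (by positivity)

/-! ### The surface `Ξ_∞` -/

theorem mem_xiDomain_iff (x : Fin 2 → ℝ) : x ∈ xiDomain ↔ 0 < discSq x := by
  have h1 : x ∈ xiDomain ↔ toComplex x ≠ 1 ∧ toComplex x ≠ -1 := xiInfty_mem_iff _
  rw [h1, discSq_eq, ← not_or, ← sq_eq_one_iff]
  constructor
  · intro h
    have : 1 - toComplex x ^ 2 ≠ 0 := fun h0 => h (by linear_combination -h0)
    positivity
  · intro h h0
    rw [h0] at h
    simp at h

theorem sqrt_discSq (x : Fin 2 → ℝ) : √(discSq x) = ‖1 - toComplex x ^ 2‖ := by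
  rw [discSq_eq, Real.sqrt_sq (norm_nonneg _)]

theorem one_add_sub_ne_zero {x : Fin 2 → ℝ} (hx : 0 < discSq x) :
    1 + toComplex x ≠ 0 ∧ 1 - toComplex x ≠ 0 := by
  rw [← mul_ne_zero_iff]
  intro h
  rw [discSq_eq, show 1 - toComplex x ^ 2 = (1 + toComplex x) * (1 - toComplex x) by ring, h] at hx
  simp at hx

theorem integrable_sphereDensity {x : Fin 2 → ℝ} (hx : 0 < discSq x) :
    Integrable (sphereDensity (toComplex x)) := by
  obtain ⟨h1, h2⟩ := one_add_sub_ne_zero hx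
  rw [integrable_sphereDensity_iff h1 h2, ← sqrt_discSq]
  exact integrableOn_radialDensity (Real.sqrt_pos.2 hx)

theorem integral_xiDensity {x : Fin 2 → ℝ} (hx : 0 < discSq x) :
    ∫ z in cylinder, xiDensity (toComplex x) z = radialFactor (discSq x) := by
  obtain ⟨h1, h2⟩ := one_add_sub_ne_zero hx
  rw [integral_xiDensity_eq_sphere (integrable_sphereDensity hx), integral_sphereDensity_eq h1 h2,
    integral_radialDensity, radialFactor, sqrt_discSq]

theorem contDiffOn_radialFactor_discSq :
    ContDiffOn ℝ 2 (fun x => radialFactor (discSq x)) xiDomain := by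
  have h1 : ContDiffOn ℝ 2 (fun x => √(discSq x)) xiDomain := by
    refine ContDiffOn.sqrt ?_ fun x hx => ((mem_xiDomain_iff x).1 hx).ne'
    unfold discSq
    fun_prop
  exact contDiffOn_const.mul ((contDiffOn_stripIntegral 2 0).comp h1
    fun x hx => Real.sqrt_pos.2 ((mem_xiDomain_iff x).1 hx))

theorem toComplex_toReal (α : ℂ) : toComplex (toReal α) = α := by
  simp [toComplex, toReal]

theorem tendsto_scalarCurvature_xiMetric {a : ℂ} (ha : a ^ 2 = 1) :
    Tendsto (fun α : ℂ => scalarCurvature xiMetric (toReal α)) (𝓝[≠] a) atTop := by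
  have ha0 : a ≠ 0 := by rintro rfl; simp at ha
  -- Near `a` the other puncture `-a` must be avoided too, for `1 - α² = (a - α)(a + α)` to be
  -- nonzero.
  have hne : a ≠ -a := fun h => ha0 (self_eq_neg.1 h)
  have hpos : ∀ᶠ α in 𝓝[≠] a, 0 < ‖1 - α ^ 2‖ := by
    filter_upwards [self_mem_nhdsWithin,
      mem_nhdsWithin_of_mem_nhds (isOpen_ne.mem_nhds hne)] with α h1 h2
    rw [norm_pos_iff, ← ha, sq_sub_sq]
    refine mul_ne_zero (fun h => h2 ?_) (fun h => h1 ?_)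
    · linear_combination h
    · exact (sub_eq_zero.1 h).symm
  have hlim : Tendsto (fun α : ℂ => ‖1 - α ^ 2‖) (𝓝[≠] a) (𝓝[>] 0) := by
    refine tendsto_nhdsWithin_iff.2 ⟨?_, hpos⟩
    have : Tendsto (fun α : ℂ => ‖1 - α ^ 2‖) (𝓝 a) (𝓝 ‖1 - a ^ 2‖) :=
      Continuous.tendsto (by fun_prop) a
    rw [ha, sub_self, norm_zero] at this
    exact this.mono_left nhdsWithin_le_nhds
  have hnorm : Tendsto (fun α : ℂ => α.re ^ 2 + α.im ^ 2) (𝓝[≠] a) (𝓝 1) := by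
    have h1 : Tendsto (fun α : ℂ => α.re ^ 2 + α.im ^ 2) (𝓝 a) (𝓝 (a.re ^ 2 + a.im ^ 2)) :=
      Continuous.tendsto (by fun_prop) a
    have h2 : a.re ^ 2 + a.im ^ 2 = 1 := by
      have : ‖a‖ ^ 2 = 1 := by rw [← norm_pow, ha, norm_one]
      rw [← this, ← Complex.normSq_eq_norm_sq, Complex.normSq_apply]
      ring
    rw [h2] at h1
    exact h1.mono_left nhdsWithin_le_nhds
  refine (hnorm.pos_mul_atTop one_pos (tendsto_radialCurvature.comp hlim)).congr' ?_
  filter_upwards [hpos] with α hα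
  have hd : √(discSq (toReal α)) = ‖1 - α ^ 2‖ := by rw [sqrt_discSq, toComplex_toReal]
  have hx : 0 < discSq (toReal α) := Real.sqrt_pos.1 (hd ▸ hα)
  rw [show xiMetric = _ from funext xiMetric_eq,
    scalarCurvature_radialFactor hx fun y hy => integral_xiDensity hy, hd]
  simp [toReal]

end Lump

/-- On `Ξ_∞` the induced `L²` metric is a genuine (convergent, positive definite, twice
continuously differentiable) metric, and its scalar curvature tends to `+∞` as `α → ±1`. -/
theorem mainTheorem7 :
    (∀ x ∈ Lump.xiDomain, ∀ i j : Fin 2,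
      IntegrableOn
        (Lump.l2Density (Lump.xiInfty (Lump.toComplex x)) (Lump.xiTangent x i)
          (Lump.xiTangent x j))
        Lump.cylinder volume) ∧
    (∀ x ∈ Lump.xiDomain, (Lump.xiMetric x).PosDef) ∧
    (∀ i j : Fin 2, ContDiffOn ℝ 2 (fun x => Lump.xiMetric x i j) Lump.xiDomain) ∧
    Tendsto (fun α : ℂ => Lump.scalarCurvature Lump.xiMetric (Lump.toReal α)) (𝓝[≠] 1) atTop ∧
    Tendsto (fun α : ℂ => Lump.scalarCurvature Lump.xiMetric (Lump.toReal α)) (𝓝[≠] (-1)) atTop :=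
  by
  refine ⟨fun x hx i j => ?_, fun x hx => ?_, fun i j => ?_,
    Lump.tendsto_scalarCurvature_xiMetric (one_pow 2),
    Lump.tendsto_scalarCurvature_xiMetric (by norm_num)⟩
  · exact Lump.integrableOn_l2Density_xi (Lump.integrableOn_xiDensity_of_integrable
      (Lump.integrable_sphereDensity ((Lump.mem_xiDomain_iff x).1 hx))) i j
  · have hx' := (Lump.mem_xiDomain_iff x).1 hx
    rw [Lump.xiMetric_eq, Lump.integral_xiDensity hx']
    refine Matrix.PosDef.one.smul ?_
    exact mul_pos (by norm_num) (Lump.stripIntegral_zero_pos (Real.sqrt_pos.2 hx'))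
  · refine (Lump.contDiffOn_radialFactor_discSq.mul
      (contDiffOn_const (c := (1 : Matrix (Fin 2) (Fin 2) ℝ) i j))).congr fun x hx => ?_
    rw [Lump.xiMetric_eq, Lump.integral_xiDensity ((Lump.mem_xiDomain_iff x).1 hx),
      Matrix.smul_apply, smul_eq_mul]
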